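/- Let $d\ge 1$ be an integer and let $\alpha>0$. Balls $B(x,r)\subset\mathbb{R}^d$ are closed Euclidean balls. For a Borel probability measure $\mu$ on $\mathbb{R}^d$, a point $x\in\operatorname{supp}\mu$, $r>0$ and $0\le\varepsilon<1$ put $$\operatorname{por}(\mu,x,r,\varepsilon)=\sup\Big\{a\ge 0:\ \inf_{y:\,B(y,ar)\subset B(x,r)}\frac{\mu(B(y,ar))}{\mu(B(x,r))}\le\varepsilon\Big\}$$ (with $\inf\emptyset=\infty$). For $0<\eta\le 1$ and $0\le \varepsilon<1$ the measure $\mu$ is called mean $(\alpha,\eta,\varepsilon)$-porous if, for $\mu$-almost every $x$, $$\liminf_{n\to\infty}\frac1n\,\big|\{i\in\{0,\dots,n-1\}:\operatorname{por}(\mu,x,2^{-i},\varepsilon)\ge\alpha\}\big|\ge\eta .$$ The packing dimension $\dim_P\mu$ is the $\mu$-essential supremum over $x$ of the upper local dimension $\limsup_{r\to0^+}\frac{\log\mu(B(x,r))}{\log r}$. Let $$c_d=\frac{2}{5\log 2\cdot 2^{4d}\cdot d^{d/2}} .$$ **Theorem.** For every $d\ge1$ and $\alpha>0$ there is a continuous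 function $t_{d,\alpha}:[0,1)\to\mathbb{R}$ with the following properties. 1. $t_{d,\alpha}(\varepsilon)>0$ for every $\varepsilon\in[0,1)$ with $\varepsilon<2^{-2d}d^{-d/2}\alpha^d$. 2. There is $\varepsilon_0>0$, depending only on $d$ and $\alpha$, such that $t_{d,\alpha}(\varepsilon)>c_d\,\alpha^d$ for all $\varepsilon\in[0,1)$ with $\varepsilon<\varepsilon_0$; in particular $t_{d,\alpha}(0)>c_d\,\alpha^d$. 3. For all $0<\eta\le1$ and $0\le\varepsilon<1$, every mean $(\alpha,\eta,\varepsilon)$-porous Borel probability measure $\mu$ on $\mathbb{R}^d$ satisfies $$\dim_P\mu\le d-\eta\cdot t_{d,\alpha}(\varepsilon).$$ -/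

import Mathlib

open MeasureTheory Filter Topology

noncomputable section

/-- The porosity `por(μ, x, r, ε)`: the supremum of all `a ≥ 0` such that the infimum of
`μ(B(y, a r)) / μ(B(x, r))` over all `y` with `B(y, a r) ⊆ B(x, r)` is at most `ε`
(closed Euclidean balls).  Quotient and infimum are taken in `[0, ∞]`, so the infimum over an
empty family of balls is `∞`. -/
def porosity {d : ℕ} (μ : Measure (EuclideanSpace ℝ (Fin d))) (x : EuclideanSpace ℝ (Fin d))
    (r ε : ℝ) : ℝ :=
  sSup {a : ℝ | 0 ≤ a ∧
    (⨅ (y : EuclideanSpace ℝ (Fin d))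
        (_ : Metric.closedBall y (a * r) ⊆ Metric.closedBall x r),
      μ (Metric.closedBall y (a * r)) / μ (Metric.closedBall x r)) ≤ ENNReal.ofReal ε}

/-- `μ` is mean `(α, η, ε)`-porous: for `μ`-almost every `x`, the scales `2⁻ⁱ` at which
`por(μ, x, 2⁻ⁱ, ε) ≥ α` have lower density at least `η`. -/
def MeanPorous {d : ℕ} (μ : Measure (EuclideanSpace ℝ (Fin d))) (α η ε : ℝ) : Prop :=
  ∀ᵐ x ∂μ, η ≤ liminf
    (fun n : ℕ => (1 / (n : ℝ)) *
      (Set.ncard {i : ℕ | i < n ∧ α ≤ porosity μ x ((2 : ℝ)⁻¹ ^ i) ε} : ℝ)) atTop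

/-- The upper local dimension `limsup_{r → 0⁺} log μ(B(x, r)) / log r` (closed balls), as an
extended real number (it is `⊤` outside the support of `μ`). -/
def upperLocalDim {d : ℕ} (μ : Measure (EuclideanSpace ℝ (Fin d)))
    (x : EuclideanSpace ℝ (Fin d)) : EReal :=
  limsup (fun r : ℝ => ENNReal.log (μ (Metric.closedBall x r)) / (Real.log r : EReal)) (𝓝[>] 0)

/-- The (upper) packing dimension of `μ`: the `μ`-essential supremum of the upper local
dimensions. -/
def packingDim {d : ℕ} (μ : Measure (EuclideanSpace ℝ (Fin d))) : EReal :=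
  essSup (upperLocalDim μ) μ

/-- The constant `c_d = 2 / (5 log 2 · 2^{4d} · d^{d/2})`. -/
def porosityConst (d : ℕ) : ℝ :=
  2 / (5 * Real.log 2 * 2 ^ (4 * d) * (d : ℝ) ^ ((d : ℝ) / 2))

end

/-! A porous measure leaves many subcells nearly empty, so typical cells carry more than their
Lebesgue share. This is quantified by betting. On a tree of cells, weights of total at most 1 at
each level are eventually at most `exp (δ n)` times the measure along almost every branch
(`ae_eventually_weight_le`), so lower bounds for `μ` follow from constructing large weights.
`betWeight` splits the weight equally among children, except that it bets a proportion `a` against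
every pending hole. Up to a bounded factor, opening a hole of share `q` gains at least `exp (a q)`,
and landing in one costs at most `exp (a / (1 - 2a))` (`betWeight_ge`). A second exponential weight
shows that a branch lands in at most about a proportion `p` of the holes it meets
(`ae_eventually_window_hits_le`), where `p` is close to `ε`. This gives `ae_eventually_cell_ge`.

In a dyadic grid, porosity at `x` and scale `2⁻ⁱ` yields a hole once `B(x, 2⁻ⁱ)` lies in a single
cell. Averaging over finitely many translated grids, some grid keeps a proportion `(1 - 2/κ -
1/N)^d` of the porous scales (`exists_shift_count_ge`). The function `t` is the maximum of two
choices of parameters, one for the constant near `ε = 0` and one for the range of positivity. -/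

open scoped ENNReal

/-! ### Weights on a tree of cells and the frequency of hits. -/

section Tree

variable {Ω I : Type*} [MeasurableSpace Ω] {μ : Measure Ω} {c : ℕ → Ω → I}

/-- The exceptional cells of level `n` have total measure at most `exp (-δ n) ∑ W n`, which is
summable in `n`; Borel–Cantelli concludes. -/
theorem ae_eventually_weight_le [Countable I] [IsFiniteMeasure μ] {W : ℕ → I → ℝ}
    (hW : ∀ n, ∑' u, ENNReal.ofReal (W n u) ≤ 1) {δ : ℝ} (hδ : 0 < δ) :
    ∀ᵐ x ∂μ, ∀ᶠ n in atTop, W n (c n x) ≤ Real.exp (δ * n) * μ.real (c n ⁻¹' {c n x}) := by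
  set B : ℕ → Set Ω := fun n =>
    {x | Real.exp (δ * n) * μ.real (c n ⁻¹' {c n x}) < W n (c n x)} with hB
  have key : ∀ n, μ (B n) ≤ ENNReal.ofReal (Real.exp (-δ)) ^ n := by
    intro n
    have hsub : B n ⊆ ⋃ u, {x | c n x = u ∧ Real.exp (δ * n) * μ.real (c n ⁻¹' {u}) < W n u} := by
      intro x hx
      simp only [Set.mem_iUnion]
      exact ⟨c n x, rfl, hx⟩
    have hpt : ∀ u, μ {x | c n x = u ∧ Real.exp (δ * n) * μ.real (c n ⁻¹' {u}) < W n u} ≤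
        ENNReal.ofReal (Real.exp (-δ * n)) * ENNReal.ofReal (W n u) := by
      intro u
      by_cases hu : Real.exp (δ * n) * μ.real (c n ⁻¹' {u}) < W n u
      · have : {x | c n x = u ∧ Real.exp (δ * n) * μ.real (c n ⁻¹' {u}) < W n u} =
            c n ⁻¹' {u} := by
          ext x; simp [hu]
        rw [this, ← ENNReal.ofReal_mul (Real.exp_pos _).le, ← ofReal_measureReal]
        apply ENNReal.ofReal_le_ofReal
        calc μ.real (c n ⁻¹' {u})
            = Real.exp (-δ * n) * (Real.exp (δ * n) * μ.real (c n ⁻¹' {u})) := by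
              rw [← mul_assoc, ← Real.exp_add]; simp
          _ ≤ _ := by gcongr
      · simp [hu]
    calc μ (B n) ≤ _ := measure_mono hsub
      _ ≤ ∑' u, μ {x | c n x = u ∧ Real.exp (δ * n) * μ.real (c n ⁻¹' {u}) < W n u} :=
        measure_iUnion_le _
      _ ≤ ∑' u, ENNReal.ofReal (Real.exp (-δ * n)) * ENNReal.ofReal (W n u) :=
        ENNReal.tsum_le_tsum hpt
      _ = ENNReal.ofReal (Real.exp (-δ * n)) * ∑' u, ENNReal.ofReal (W n u) :=
        ENNReal.tsum_mul_left
      _ ≤ ENNReal.ofReal (Real.exp (-δ * n)) * 1 := by gcongr; exact hW n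
      _ = ENNReal.ofReal (Real.exp (-δ)) ^ n := by
        rw [mul_one, ← ENNReal.ofReal_pow (Real.exp_pos _).le, ← Real.exp_nat_mul]
        ring_nf
  have hsum : ∑' n, μ (B n) ≠ ⊤ := by
    refine ne_top_of_le_ne_top ?_ (ENNReal.tsum_le_tsum key)
    rw [ENNReal.tsum_geometric]
    refine ENNReal.inv_ne_top.mpr (tsub_pos_of_lt ?_).ne'
    rw [ENNReal.ofReal_lt_one]
    simpa using hδ
  filter_upwards [ae_eventually_notMem hsum] with x hx
  filter_upwards [hx] with n hn
  simpa [hB] using hn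

theorem ae_cell_pos [Countable I] [IsFiniteMeasure μ] : ∀ᵐ x ∂μ, ∀ n, 0 < μ.real (c n ⁻¹' {c n x}) := by
  rw [ae_all_iff]
  intro n
  have hnull : ∀ᵐ x ∂μ, ∀ u, μ (c n ⁻¹' {u}) = 0 → c n x ≠ u := by
    rw [ae_all_iff]
    intro u
    by_cases hu : μ (c n ⁻¹' {u}) = 0
    · have : ∀ᵐ x ∂μ, x ∉ c n ⁻¹' {u} := measure_eq_zero_iff_ae_notMem.mp hu
      filter_upwards [this] with x hx _ using hx
    · exact Eventually.of_forall fun x h => absurd h hu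
  filter_upwards [hnull] with x hx
  exact ENNReal.toReal_pos (fun h => hx _ h rfl) (measure_ne_top _ _)

theorem tsum_eq_tsum_fiber (par : I → I) (f : I → ℝ≥0∞) :
    ∑' v, f v = ∑' u, ∑' v, Set.indicator {v | par v = u} f v := by
  rw [ENNReal.tsum_comm]
  refine tsum_congr fun v => ?_
  rw [tsum_eq_single (par v)]
  · simp
  · intro u hu
    simp [hu.symm]

open Classical in
/-- The exponential weights of the events of landing, from the cells `D j`, in the children
selected by `h`. -/
noncomputable def hitWeight (par : I → I) (D : ℕ → Set I) (h : ℕ → I → I) (p s : ℝ) :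
    ℕ → I → ℝ
  | 0, _ => 1
  | n + 1, v => hitWeight par D h p s n (par v) *
      Real.exp (s * ((if par v ∈ D n ∧ v = h n (par v) then 1 else 0) -
        p * (if par v ∈ D n then 1 else 0)) - s ^ 2)

theorem hitWeight_nonneg (par : I → I) (D : ℕ → Set I) (h : ℕ → I → I) (p s : ℝ) (n : ℕ)
    (v : I) : 0 ≤ hitWeight par D h p s n v := by
  induction n generalizing v with
  | zero => simp [hitWeight]
  | succ n ih => rw [hitWeight]; exact mul_nonneg (ih _) (Real.exp_pos _).le

/-- Exponential moment of an event of probability `p`: the correction `s ^ 2` absorbs the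
second-order term of `exp s`. -/
theorem exp_hit_bound {p s : ℝ} (hp0 : 0 ≤ p) (hp1 : p ≤ 1) (hs0 : 0 ≤ s) (hs1 : s ≤ 1) :
    Real.exp (-(s * p) - s ^ 2) * (1 + (Real.exp s - 1) * p) ≤ 1 := by
  have h1 : Real.exp s - 1 ≤ s + s ^ 2 := by
    have := Real.abs_exp_sub_one_sub_id_le (x := s) (by rwa [abs_of_nonneg hs0])
    have := (abs_le.mp this).2
    linarith
  have h2 : 1 + (Real.exp s - 1) * p ≤ Real.exp (s * p + s ^ 2) := by
    have := Real.add_one_le_exp (s * p + s ^ 2)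
    nlinarith [mul_le_mul_of_nonneg_right h1 hp0, sq_nonneg s]
  calc _ ≤ Real.exp (-(s * p) - s ^ 2) * Real.exp (s * p + s ^ 2) := by gcongr
    _ = 1 := by rw [← Real.exp_add]; simp

variable [MeasurableSpace I] [MeasurableSingletonClass I]

theorem tsum_fiber_measure_le {par : I → I} {n : ℕ} (hc : ∀ n, Measurable (c n))
    (hpar : ∀ n x, par (c (n + 1) x) = c n x) (u : I) :
    ∑' v, Set.indicator {v | par v = u} (fun v => μ (c (n + 1) ⁻¹' {v})) v ≤
      μ (c n ⁻¹' {u}) := by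
  have h1 : ∀ v, Set.indicator {v | par v = u} (fun v => μ (c (n + 1) ⁻¹' {v})) v =
      μ (c (n + 1) ⁻¹' {v} ∩ c n ⁻¹' {u}) := by
    intro v
    by_cases hv : par v = u
    · rw [Set.indicator_of_mem (show v ∈ {v | par v = u} from hv)]
      congr 1
      ext x
      simp only [Set.mem_preimage, Set.mem_singleton_iff, Set.mem_inter_iff, iff_self_and]
      rintro rfl
      rw [← hv, hpar]
    · rw [Set.indicator_of_notMem (show v ∉ {v | par v = u} from hv), eq_comm]
      convert measure_empty (μ := μ)
      ext x
      simp only [Set.mem_preimage, Set.mem_singleton_iff, Set.mem_inter_iff,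
        Set.mem_empty_iff_false, iff_false, not_and]
      rintro rfl h
      exact hv (by rw [hpar, h])
  simp_rw [h1]
  refine (tsum_meas_le_meas_iUnion_of_disjoint μ (fun v => ?_) ?_).trans (measure_mono ?_)
  · exact (hc _ (measurableSet_singleton v)).inter (hc _ (measurableSet_singleton u))
  · intro v w hvw
    refine Set.disjoint_left.mpr ?_
    rintro x ⟨h, -⟩ ⟨h', -⟩
    exact hvw (h.symm.trans h')
  · exact Set.iUnion_subset fun v => Set.inter_subset_right

theorem tsum_cell_le_one [IsProbabilityMeasure μ] (hc : ∀ n, Measurable (c n)) (n : ℕ) :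
    ∑' u, μ (c n ⁻¹' {u}) ≤ 1 := by
  refine (tsum_meas_le_meas_iUnion_of_disjoint μ (fun v => ?_) ?_).trans prob_le_one
  · exact hc _ (measurableSet_singleton v)
  · intro v w hvw
    refine Set.disjoint_left.mpr ?_
    intro x h h'
    exact hvw (h.symm.trans h')

/-- Supermartingale property: below a cell of `D n` the selected child has conditional probability
at most `p`, so `exp_hit_bound` bounds the expected factor by 1; below any other cell the factor is
at most 1. -/
theorem tsum_hitWeight_le_one [IsProbabilityMeasure μ] {par : I → I}
    (hc : ∀ n, Measurable (c n)) (hpar : ∀ n x, par (c (n + 1) x) = c n x)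
    {D : ℕ → Set I} {h : ℕ → I → I} {p s : ℝ} (hp0 : 0 ≤ p) (hp1 : p ≤ 1)
    (hs0 : 0 ≤ s) (hs1 : s ≤ 1)
    (hD : ∀ n, ∀ u ∈ D n, μ (c (n + 1) ⁻¹' {h n u}) ≤ ENNReal.ofReal p * μ (c n ⁻¹' {u}))
    (n : ℕ) :
    ∑' u, ENNReal.ofReal (hitWeight par D h p s n u) * μ (c n ⁻¹' {u}) ≤ 1 := by
  classical
  induction n with
  | zero => simpa [hitWeight] using tsum_cell_le_one hc 0
  | succ n ih =>
    refine le_trans ?_ ih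
    rw [tsum_eq_tsum_fiber par]
    refine ENNReal.tsum_le_tsum fun u => ?_
    set M := fun v => μ (c (n + 1) ⁻¹' {v}) with hM
    have hfib := tsum_fiber_measure_le (μ := μ) (n := n) hc hpar u
    have hs' : 0 ≤ Real.exp s - 1 := by linarith [Real.add_one_le_exp s]
    by_cases hu : u ∈ D n
    · have hpt : ∀ v, Set.indicator {v | par v = u}
          (fun v => ENNReal.ofReal (hitWeight par D h p s (n + 1) v) * M v) v ≤
          ENNReal.ofReal (hitWeight par D h p s n u) *
            (ENNReal.ofReal (Real.exp (-(s * p) - s ^ 2)) *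
              (Set.indicator {v | par v = u} M v +
                ENNReal.ofReal (Real.exp s - 1) * (if v = h n u then M v else 0))) := by
        intro v
        by_cases hv : par v = u
        · rw [Set.indicator_of_mem (show v ∈ {v | par v = u} from hv),
            Set.indicator_of_mem (show v ∈ {v | par v = u} from hv), hitWeight, hv,
            ENNReal.ofReal_mul (hitWeight_nonneg ..), mul_assoc]
          refine mul_le_mul' le_rfl ?_
          by_cases hvh : v = h n u
          · rw [if_pos ⟨hu, hvh⟩, if_pos hvh, if_pos hu]
            have : Real.exp (s * (1 - p * 1) - s ^ 2) =
                Real.exp (-(s * p) - s ^ 2) * (1 + (Real.exp s - 1)) := by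
              rw [add_sub_cancel, ← Real.exp_add]; ring_nf
            rw [this, ENNReal.ofReal_mul (Real.exp_pos _).le,
              ENNReal.ofReal_add zero_le_one hs', ENNReal.ofReal_one, mul_assoc, add_mul, one_mul]
          · rw [if_neg (fun h => hvh h.2), if_neg hvh, if_pos hu, mul_zero, add_zero]
            apply le_of_eq
            ring_nf
        · rw [Set.indicator_of_notMem (show v ∉ {v | par v = u} from hv)]
          exact zero_le
      refine (ENNReal.tsum_le_tsum hpt).trans ?_
      rw [ENNReal.tsum_mul_left, ENNReal.tsum_mul_left, ENNReal.tsum_add, ENNReal.tsum_mul_left,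
        tsum_ite_eq]
      gcongr
      calc _ ≤ ENNReal.ofReal (Real.exp (-(s * p) - s ^ 2)) * (μ (c n ⁻¹' {u}) +
            ENNReal.ofReal (Real.exp s - 1) * (ENNReal.ofReal p * μ (c n ⁻¹' {u}))) := by
            gcongr
            exact hD n u hu
        _ = ENNReal.ofReal (Real.exp (-(s * p) - s ^ 2) * (1 + (Real.exp s - 1) * p)) *
            μ (c n ⁻¹' {u}) := by
            rw [ENNReal.ofReal_mul (Real.exp_pos _).le,
              ENNReal.ofReal_add zero_le_one (mul_nonneg hs' hp0), ENNReal.ofReal_mul hs',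
              ENNReal.ofReal_one]
            ring
        _ ≤ 1 * μ (c n ⁻¹' {u}) := by
            gcongr
            rw [← ENNReal.ofReal_one]
            exact ENNReal.ofReal_le_ofReal (exp_hit_bound hp0 hp1 hs0 hs1)
        _ = _ := one_mul _
    · have hpt : ∀ v, Set.indicator {v | par v = u}
          (fun v => ENNReal.ofReal (hitWeight par D h p s (n + 1) v) * M v) v ≤
          ENNReal.ofReal (hitWeight par D h p s n u) * Set.indicator {v | par v = u} M v := by
        intro v
        by_cases hv : par v = u
        · rw [Set.indicator_of_mem (show v ∈ {v | par v = u} from hv),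
            Set.indicator_of_mem (show v ∈ {v | par v = u} from hv), hitWeight, hv]
          gcongr
          rw [if_neg (fun h => hu h.1), if_neg hu]
          refine mul_le_of_le_one_right (hitWeight_nonneg ..) ?_
          rw [Real.exp_le_one_iff]
          nlinarith [sq_nonneg s]
        · simp [hv]
      refine (ENNReal.tsum_le_tsum hpt).trans ?_
      rw [ENNReal.tsum_mul_left]
      gcongr

open Classical in
theorem ae_eventually_hits_le [Countable I] [IsProbabilityMeasure μ] {par : I → I}
    (hc : ∀ n, Measurable (c n)) (hpar : ∀ n x, par (c (n + 1) x) = c n x)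
    {D : ℕ → Set I} {h : ℕ → I → I} {p : ℝ} (hp0 : 0 ≤ p) (hp1 : p ≤ 1)
    (hD : ∀ n, ∀ u ∈ D n, μ (c (n + 1) ⁻¹' {h n u}) ≤ ENNReal.ofReal p * μ (c n ⁻¹' {u}))
    {δ : ℝ} (hδ : 0 < δ) :
    ∀ᵐ x ∂μ, ∀ᶠ n in atTop,
      ∑ j ∈ Finset.range n, (if c j x ∈ D j ∧ c (j + 1) x = h j (c j x) then (1 : ℝ) else 0) ≤
        p * ∑ j ∈ Finset.range n, (if c j x ∈ D j then (1 : ℝ) else 0) + δ * n := by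
  -- The error `s ^ 2 * n` occurs twice, in `hitWeight` and in the comparison with `μ`; after
  -- division by `s` it amounts to `2 * s * n ≤ δ * n`.
  set s : ℝ := min 1 (δ / 2) with hs
  have hs0 : 0 < s := by positivity
  have hs1 : s ≤ 1 := min_le_left _ _
  have hs2 : 2 * s ≤ δ := by have := min_le_right 1 (δ / 2); linarith
  have hW : ∀ n, ∑' u, ENNReal.ofReal (hitWeight par D h p s n u * μ.real (c n ⁻¹' {u})) ≤ 1 := by
    intro n
    refine le_of_eq_of_le (tsum_congr fun u => ?_)
      (tsum_hitWeight_le_one hc hpar hp0 hp1 hs0.le hs1 hD n)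
    rw [ENNReal.ofReal_mul (hitWeight_nonneg ..), ofReal_measureReal]
  have hval : ∀ x n, hitWeight par D h p s n (c n x) = Real.exp (s * (
      ∑ j ∈ Finset.range n, (if c j x ∈ D j ∧ c (j + 1) x = h j (c j x) then (1 : ℝ) else 0) -
        p * ∑ j ∈ Finset.range n, (if c j x ∈ D j then (1 : ℝ) else 0)) - s ^ 2 * n) := by
    intro x n
    induction n with
    | zero => simp [hitWeight]
    | succ n ih =>
      rw [hitWeight, hpar, ih, ← Real.exp_add, Finset.sum_range_succ, Finset.sum_range_succ]
      push_cast
      ring_nf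
  filter_upwards [ae_eventually_weight_le (c := c) hW (pow_pos hs0 2),
    ae_cell_pos (μ := μ) (c := c)] with x hx hpos
  filter_upwards [hx] with n hn
  have h1 := le_of_mul_le_mul_right hn (hpos n)
  rw [hval, Real.exp_le_exp] at h1
  have h2 : s * (∑ j ∈ Finset.range n,
      (if c j x ∈ D j ∧ c (j + 1) x = h j (c j x) then (1 : ℝ) else 0) -
        p * ∑ j ∈ Finset.range n, (if c j x ∈ D j then (1 : ℝ) else 0)) ≤ s * (2 * s * n) := by
    linarith
  have h3 := le_of_mul_le_mul_left h2 hs0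
  nlinarith [(Nat.cast_nonneg n : (0 : ℝ) ≤ n)]

end Tree

/-! ### Hits of holes lying `m` levels deeper. -/

theorem sum_range_mul_eq (f : ℕ → ℝ) (m J : ℕ) :
    ∑ i ∈ Finset.range (m * J), f i =
      ∑ r ∈ Finset.range m, ∑ j ∈ Finset.range J, f (r + m * j) := by
  induction J with
  | zero => simp
  | succ J ih =>
    rw [Nat.mul_succ, Finset.sum_range_add, ih, ← Finset.sum_add_distrib]
    refine Finset.sum_congr rfl fun r _ => ?_
    rw [Finset.sum_range_succ, add_comm r (m * J)]

section Tree

theorem iterate_parent {Ω I : Type*} {c : ℕ → Ω → I} {par : I → I} (hpar : ∀ n x, par (c (n + 1) x) = c n x) (n k : ℕ) (x : Ω) :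
    par^[k] (c (n + k) x) = c n x := by
  induction k with
  | zero => rfl
  | succ k ih => rw [Function.iterate_succ_apply, ← add_assoc, hpar, ih]

variable {Ω I : Type*} [MeasurableSpace Ω] {μ : Measure Ω} {c : ℕ → Ω → I}

open Classical in
-- Along each residue class of levels modulo `m`, the cells form a tree with parent map `par^[m]`,
-- in which a hole is a child; the one-step bound is summed over the classes.
theorem ae_eventually_window_hits_le [Countable I] [MeasurableSpace I]
    [MeasurableSingletonClass I] [IsProbabilityMeasure μ] {par : I → I}
    (hc : ∀ n, Measurable (c n)) (hpar : ∀ n x, par (c (n + 1) x) = c n x)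
    {m : ℕ} (hm : 0 < m) {D : ℕ → Set I} {h : ℕ → I → I} {p : ℝ} (hp0 : 0 ≤ p) (hp1 : p ≤ 1)
    (hD : ∀ n, ∀ u ∈ D n, μ (c (n + m) ⁻¹' {h n u}) ≤ ENNReal.ofReal p * μ (c n ⁻¹' {u}))
    {δ : ℝ} (hδ : 0 < δ) :
    ∀ᵐ x ∂μ, ∀ᶠ n in atTop,
      ∑ j ∈ Finset.range n, (if c j x ∈ D j ∧ c (j + m) x = h j (c j x) then (1 : ℝ) else 0) ≤
        p * ∑ j ∈ Finset.range n, (if c j x ∈ D j then (1 : ℝ) else 0) + δ * n := by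
  have hidx : ∀ r j, r + m * (j + 1) = r + m * j + m := fun r j => by ring
  have key : ∀ r : ℕ, ∀ᵐ x ∂μ, ∀ᶠ J in atTop,
      ∑ j ∈ Finset.range J, (if c (r + m * j) x ∈ D (r + m * j) ∧
        c (r + m * j + m) x = h (r + m * j) (c (r + m * j) x) then (1 : ℝ) else 0) ≤
        p * ∑ j ∈ Finset.range J, (if c (r + m * j) x ∈ D (r + m * j) then (1 : ℝ) else 0) +
          δ / 2 * J := by
    intro r
    have := ae_eventually_hits_le (μ := μ) (c := fun j => c (r + m * j)) (par := par^[m])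
      (fun j => hc _) (fun j x => by rw [hidx]; exact iterate_parent hpar _ _ _)
      (D := fun j => D (r + m * j)) (h := fun j => h (r + m * j)) hp0 hp1
      (fun j u hu => by rw [hidx]; exact hD _ u hu) (half_pos hδ)
    simpa only [hidx] using this
  filter_upwards [ae_all_iff.mpr key] with x hx
  have hall : ∀ᶠ J in atTop, ∀ r ∈ Finset.range m,
      ∑ j ∈ Finset.range J, (if c (r + m * j) x ∈ D (r + m * j) ∧
        c (r + m * j + m) x = h (r + m * j) (c (r + m * j) x) then (1 : ℝ) else 0) ≤
        p * ∑ j ∈ Finset.range J, (if c (r + m * j) x ∈ D (r + m * j) then (1 : ℝ) else 0) +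
          δ / 2 * J :=
    (Finset.eventually_all _).mpr fun r _ => hx r
  -- Rounding up to `n / m + 1` blocks overshoots `n` by at most `m` levels; `n₀` makes the cost of
  -- the overshoot at most `δ / 2 * n`.
  have hdiv : Tendsto (fun n : ℕ => n / m + 1) atTop atTop :=
    (tendsto_add_atTop_nat 1).comp (Nat.tendsto_div_const_atTop hm.ne')
  obtain ⟨n₀, hn₀⟩ := exists_nat_ge (2 * (p * m + δ / 2 * m) / δ)
  filter_upwards [hdiv.eventually hall, eventually_ge_atTop n₀] with n hn hnn
  set J := n / m + 1 with hJ
  have hJ1 : n ≤ m * J := by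
    have := Nat.div_add_mod n m
    have := Nat.mod_lt n hm
    rw [hJ, Nat.mul_succ]
    omega
  have hJ2 : m * J ≤ n + m := by
    have := Nat.div_mul_le_self n m
    rw [hJ, Nat.mul_succ]
    linarith [mul_comm m (n / m)]
  have hsum := Finset.sum_le_sum hn
  rw [Finset.sum_add_distrib, ← Finset.mul_sum, Finset.sum_const, Finset.card_range,
    nsmul_eq_mul] at hsum
  rw [← sum_range_mul_eq (fun i => if c i x ∈ D i ∧ c (i + m) x = h i (c i x) then (1 : ℝ) else 0),
    ← sum_range_mul_eq (fun i => if c i x ∈ D i then (1 : ℝ) else 0)] at hsum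
  have h1 : ∑ j ∈ Finset.range n,
      (if c j x ∈ D j ∧ c (j + m) x = h j (c j x) then (1 : ℝ) else 0) ≤
      ∑ j ∈ Finset.range (m * J),
      (if c j x ∈ D j ∧ c (j + m) x = h j (c j x) then (1 : ℝ) else 0) :=
    Finset.sum_le_sum_of_subset_of_nonneg (Finset.range_mono hJ1)
      fun i _ _ => by split_ifs <;> norm_num
  have h2 : ∑ j ∈ Finset.range (m * J), (if c j x ∈ D j then (1 : ℝ) else 0) ≤
      ∑ j ∈ Finset.range n, (if c j x ∈ D j then (1 : ℝ) else 0) + m := by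
    calc _ ≤ ∑ j ∈ Finset.range (n + m), (if c j x ∈ D j then (1 : ℝ) else 0) :=
          Finset.sum_le_sum_of_subset_of_nonneg (Finset.range_mono hJ2)
            fun i _ _ => by split_ifs <;> norm_num
      _ ≤ _ := by
        rw [Finset.sum_range_add]
        gcongr
        calc _ ≤ ∑ _i ∈ Finset.range m, (1 : ℝ) :=
              Finset.sum_le_sum fun i _ => by split_ifs <;> norm_num
          _ = m := by simp
  have h3 : (m : ℝ) * J ≤ n + m := by exact_mod_cast hJ2
  have h4 : 2 * (p * m + δ / 2 * m) ≤ δ * n := by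
    have : 2 * (p * m + δ / 2 * m) / δ ≤ n := hn₀.trans (by exact_mod_cast hnn)
    rw [div_le_iff₀ hδ] at this
    linarith
  have h5 := mul_le_mul_of_nonneg_left h2 hp0
  have h6 := mul_le_mul_of_nonneg_left h3 (half_pos hδ).le
  nlinarith

end Tree

/-! ### Betting against the pending holes. -/

theorem sum_half_pow_le_one (n m : ℕ) :
    ∑ i ∈ Finset.range (n + 1), (if n < i + m then (2⁻¹ : ℝ) ^ (i + m - n) else 0) ≤ 1 := by
  have key : ∀ J, ∑ j ∈ Finset.range J, (if j < m then (2⁻¹ : ℝ) ^ (m - j) else 0) ≤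
      (2⁻¹ : ℝ) ^ (m - J) := by
    intro J
    induction J with
    | zero => simp
    | succ J ih =>
      rw [Finset.sum_range_succ]
      split_ifs with hJ
      · have : m - J = (m - (J + 1)) + 1 := by omega
        rw [this, pow_succ] at ih ⊢
        linarith
      · rw [show m - (J + 1) = m - J by omega]
        linarith
  rw [← Finset.sum_range_reflect]
  refine le_trans (Finset.sum_le_sum (g := fun j => if j < m then (2⁻¹ : ℝ) ^ (m - j) else 0)
    fun j hj => le_of_eq ?_) ((key (n + 1)).trans (pow_le_one₀ (by norm_num) (by norm_num)))
  rw [Finset.mem_range] at hj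
  by_cases h : j < m
  · rw [if_pos (by omega), if_pos h, show n + 1 - 1 - j + m - n = m - j by omega]
  · rw [if_neg (by omega), if_neg h]

section Betting

variable {I : Type*} (par : I → I) (D : ℕ → Set I) (h : ℕ → I → I) (b : ℝ) (m : ℕ)

open Classical in
/-- The proportion of the cell `u` of level `n` that is occupied by the hole `h i v` of its
ancestor `v` of level `i`, when each cell is split into `b` equal cells at each step. -/
noncomputable def holeShare (i n : ℕ) (u : I) : ℝ :=
  if par^[n - i] u ∈ D i ∧ par^[i + m - n] (h i (par^[n - i] u)) = u then b⁻¹ ^ (i + m - n) else 0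

/-- The proportion of the cell `u` of level `n` in the holes pending at level `n`. -/
noncomputable def pendingShare (n : ℕ) (u : I) : ℝ :=
  ∑ i ∈ Finset.range (n + 1), if n < i + m then holeShare par D h b m i n u else 0

/-- The proportion of the cell `v` of level `n + 1` in the holes pending at level `n`. -/
noncomputable def refinedShare (n : ℕ) (v : I) : ℝ :=
  ∑ i ∈ Finset.range (n + 1), if n < i + m then holeShare par D h b m i (n + 1) v else 0

/-- Weights on the cells, starting from `w₀` and betting the proportion `a` against the
pending holes. -/
noncomputable def betWeight (a : ℝ) (w₀ : I → ℝ) : ℕ → I → ℝ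
  | 0, u => w₀ u
  | n + 1, v => betWeight a w₀ n (par v) *
      (b⁻¹ * (1 - a * refinedShare par D h b m n v) / (1 - a * pendingShare par D h b m n (par v)))

variable {par D h b m}

theorem holeShare_nonneg (hb : 0 ≤ b) (i n : ℕ) (u : I) : 0 ≤ holeShare par D h b m i n u := by
  rw [holeShare]
  split_ifs <;> positivity

theorem holeShare_le (hb : 2 ≤ b) (i n : ℕ) (u : I) :
    holeShare par D h b m i n u ≤ 2⁻¹ ^ (i + m - n) := by
  rw [holeShare]
  split_ifs
  · gcongr
  · positivity

/-- Overlaps need no care: pending holes come from levels `n - m < i ≤ n`, with distinct exponents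
`i + m - n` between 1 and `m`, so their shares sum to less than a geometric series of total 1. -/
theorem pendingShare_le_one (hb : 2 ≤ b) (n : ℕ) (u : I) : pendingShare par D h b m n u ≤ 1 := by
  refine le_trans (Finset.sum_le_sum fun i _ => ?_) (sum_half_pow_le_one n m)
  split_ifs
  · exact holeShare_le hb _ _ _
  · rfl

/-- Each exponent drops by one, which doubles the previous bound. This is the reason for requiring
`a < 1 / 2`. -/
theorem refinedShare_le_two (hb : 2 ≤ b) (n : ℕ) (u : I) :
    refinedShare par D h b m n u ≤ 2 := by
  calc refinedShare par D h b m n u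
      ≤ ∑ i ∈ Finset.range (n + 1), 2 * (if n < i + m then (2⁻¹ : ℝ) ^ (i + m - n) else 0) := by
        refine Finset.sum_le_sum fun i _ => ?_
        split_ifs with hi
        · refine (holeShare_le hb _ _ _).trans (le_of_eq ?_)
          rw [show i + m - n = (i + m - (n + 1)) + 1 by omega, pow_succ]
          ring
        · simp
    _ ≤ 2 := by
        rw [← Finset.mul_sum]
        linarith [sum_half_pow_le_one n m]

/-- A hole still deeper than level `n` lies in a single child, where its share is `b` times larger.
-/
theorem sum_fiber_holeShare {fib : I → Finset I} (hfib : ∀ u v, v ∈ fib u ↔ par v = u)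
    (hb : b ≠ 0) {i n : ℕ} (hin : i ≤ n) (hnm : n < i + m) (u : I) :
    ∑ v ∈ fib u, holeShare par D h b m i (n + 1) v = b * holeShare par D h b m i n u := by
  classical
  have h1 : ∀ v ∈ fib u, holeShare par D h b m i (n + 1) v =
      if par^[i + m - (n + 1)] (h i (par^[n - i] u)) = v then
        (if par^[n - i] u ∈ D i then b⁻¹ ^ (i + m - (n + 1)) else 0) else 0 := by
    intro v hv
    rw [holeShare, show n + 1 - i = (n - i) + 1 by omega, Function.iterate_succ_apply,
      (hfib u v).mp hv]
    by_cases h1 : par^[n - i] u ∈ D i <;> simp [h1]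
  have h2 : i + m - n = (i + m - (n + 1)) + 1 := by omega
  have h4 : par^[i + m - (n + 1)] (h i (par^[n - i] u)) ∈ fib u ↔
      par^[i + m - (n + 1) + 1] (h i (par^[n - i] u)) = u := by
    rw [hfib, Function.iterate_succ_apply']
  rw [Finset.sum_congr rfl h1, Finset.sum_ite_eq, holeShare, h2, pow_succ]
  by_cases h3 : par^[n - i] u ∈ D i
  · simp only [h3, h4, true_and, if_true, mul_ite, mul_zero]
    congr 1
    field_simp
  · simp [h3]

theorem sum_fiber_refinedShare {fib : I → Finset I} (hfib : ∀ u v, v ∈ fib u ↔ par v = u)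
    (hb : b ≠ 0) (n : ℕ) (u : I) :
    ∑ v ∈ fib u, refinedShare par D h b m n v = b * pendingShare par D h b m n u := by
  simp only [refinedShare, pendingShare]
  rw [Finset.sum_comm, Finset.mul_sum]
  refine Finset.sum_congr rfl fun i hi => ?_
  split_ifs with hnm
  · exact sum_fiber_holeShare hfib hb (by simpa [Nat.lt_succ_iff] using hi) hnm u
  · simp

theorem one_half_le_pending {a : ℝ} (hb : 2 ≤ b) (ha0 : 0 ≤ a) (ha1 : a < 1 / 2) (n : ℕ) (u : I) :
    1 / 2 ≤ 1 - a * pendingShare par D h b m n u := by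
  nlinarith [pendingShare_le_one (par := par) (D := D) (h := h) (m := m) hb n u]

theorem refined_ge {a : ℝ} (hb : 2 ≤ b) (ha0 : 0 ≤ a) (n : ℕ) (u : I) :
    1 - 2 * a ≤ 1 - a * refinedShare par D h b m n u := by
  nlinarith [refinedShare_le_two (par := par) (D := D) (h := h) (m := m) hb n u]

theorem betWeight_nonneg {a : ℝ} {w₀ : I → ℝ} (hb : 2 ≤ b) (ha0 : 0 ≤ a) (ha1 : a < 1 / 2)
    (hw : ∀ u, 0 ≤ w₀ u) (n : ℕ) (u : I) : 0 ≤ betWeight par D h b m a w₀ n u := by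
  induction n generalizing u with
  | zero => exact hw u
  | succ n ih =>
    rw [betWeight]
    have h1 := one_half_le_pending (par := par) (D := D) (h := h) (m := m) hb ha0 ha1 n (par u)
    have h2 := refined_ge (par := par) (D := D) (h := h) (m := m) hb ha0 n u
    refine mul_nonneg (ih _) (div_nonneg (mul_nonneg (by positivity) ?_) ?_) <;> linarith

/-- The refined shares of the children average to the pending share of the parent, so the
denominator in `betWeight` is the right normalisation. -/
theorem sum_fiber_betWeight {fib : I → Finset I} (hfib : ∀ u v, v ∈ fib u ↔ par v = u)
    (hcard : ∀ u, ((fib u).card : ℝ) = b) (hb : 2 ≤ b) {a : ℝ} {w₀ : I → ℝ} (ha0 : 0 ≤ a)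
    (ha1 : a < 1 / 2) (n : ℕ) (u : I) :
    ∑ v ∈ fib u, betWeight par D h b m a w₀ (n + 1) v = betWeight par D h b m a w₀ n u := by
  have h1 := one_half_le_pending (par := par) (D := D) (h := h) (m := m) hb ha0 ha1 n u
  have h0 : ∀ v ∈ fib u, betWeight par D h b m a w₀ (n + 1) v =
      betWeight par D h b m a w₀ n u * b⁻¹ / (1 - a * pendingShare par D h b m n u) *
        (1 - a * refinedShare par D h b m n v) := by
    intro v hv
    rw [betWeight, (hfib u v).mp hv]
    ring
  rw [Finset.sum_congr rfl h0, ← Finset.mul_sum, Finset.sum_sub_distrib, ← Finset.mul_sum,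
    sum_fiber_refinedShare hfib (by positivity), Finset.sum_const, nsmul_eq_mul, hcard]
  have : (1 - a * pendingShare par D h b m n u) ≠ 0 := by linarith
  field_simp

theorem tsum_betWeight {fib : I → Finset I} (hfib : ∀ u v, v ∈ fib u ↔ par v = u)
    (hcard : ∀ u, ((fib u).card : ℝ) = b) (hb : 2 ≤ b) {a : ℝ} {w₀ : I → ℝ} (ha0 : 0 ≤ a)
    (ha1 : a < 1 / 2) (hw : ∀ u, 0 ≤ w₀ u) (n : ℕ) :
    ∑' u, ENNReal.ofReal (betWeight par D h b m a w₀ n u) = ∑' u, ENNReal.ofReal (w₀ u) := by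
  induction n with
  | zero => rfl
  | succ n ih =>
    rw [tsum_eq_tsum_fiber par, ← ih]
    refine tsum_congr fun u => ?_
    rw [tsum_eq_sum (s := fib u), ← sum_fiber_betWeight hfib hcard hb ha0 ha1,
      ENNReal.ofReal_sum_of_nonneg fun v _ => betWeight_nonneg hb ha0 ha1 hw _ _]
    · exact Finset.sum_congr rfl fun v hv =>
        Set.indicator_of_mem (show v ∈ {v | par v = u} from (hfib u v).mp hv) _
    · intro v hv
      exact Set.indicator_of_notMem (s := {v | par v = u}) (fun hv' => hv ((hfib u v).mpr hv')) _

open Classical in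
-- On reaching level `n + 1`, the hole opened at level `n + 1 - m` expires and the hole of `v`
-- itself, if any, opens.
theorem pendingShare_succ (hm : 0 < m) (hD : ∀ n, ∀ u ∈ D n, par^[m] (h n u) = u) (n : ℕ) (v : I) :
    pendingShare par D h b m (n + 1) v = refinedShare par D h b m n v -
      (if m ≤ n + 1 then holeShare par D h b m (n + 1 - m) (n + 1) v else 0) +
      (if v ∈ D (n + 1) then b⁻¹ ^ m else 0) := by
  rw [pendingShare, Finset.sum_range_succ, if_pos (by omega)]
  congr 1
  · rw [eq_sub_iff_add_eq]
    have h1 : (if m ≤ n + 1 then holeShare par D h b m (n + 1 - m) (n + 1) v else 0) =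
        ∑ i ∈ Finset.range (n + 1),
          if n + 1 - m = i then
            (if m ≤ n + 1 then holeShare par D h b m i (n + 1) v else 0) else 0 := by
      rw [Finset.sum_ite_eq, if_pos (Finset.mem_range.mpr (by omega))]
    rw [h1, ← Finset.sum_add_distrib, refinedShare]
    refine Finset.sum_congr rfl fun i hi => ?_
    rw [Finset.mem_range] at hi
    split_ifs <;> first | (exfalso; omega) | simp
  · have h2 : holeShare par D h b m (n + 1) (n + 1) v =
        if v ∈ D (n + 1) ∧ par^[m] (h (n + 1) v) = v then b⁻¹ ^ m else 0 := by
      simp [holeShare]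
    rw [h2]
    by_cases hv : v ∈ D (n + 1)
    · rw [if_pos hv, if_pos ⟨hv, hD _ _ hv⟩]
    · rw [if_neg hv, if_neg fun h' => hv h'.1]

end Betting

/-- One step of the bet: `S` is the refined share, `t` the share that expires, `e` the indicator of
an opening. Opening gains at least `exp (a q e)` because the cross term of `(1 - a (S - t)) (1 - a q
e)` is nonnegative. Expiry costs at most `1 + a t / (1 - a S)`, and `S ≤ 2` gives the denominator `1
- 2a`. -/
theorem one_sub_le_mul_exp {a q S t e : ℝ} (ha0 : 0 ≤ a) (ha1 : a < 1 / 2) (hq : 0 ≤ q)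
    (hS : S ≤ 2) (ht0 : 0 ≤ t) (htS : t ≤ S) (he : 0 ≤ e) :
    (1 - a * (S - t + q * e)) * Real.exp (a * q * e - a / (1 - 2 * a) * t) ≤ 1 - a * S := by
  have hden : 0 < 1 - 2 * a := by linarith
  set L := a / (1 - 2 * a) with hL
  have hL0 : 0 ≤ L := by positivity
  have hLa : a = L * (1 - 2 * a) := (div_mul_cancel₀ a hden.ne').symm
  have hSpos : 0 < 1 - a * S := by nlinarith
  have h1 : 1 - a * (S - t + q * e) ≤ (1 - a * S + a * t) * (1 - a * q * e) := by
    have h2 : 0 ≤ (a * q * e) * (a * (S - t)) := by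
      have := sub_nonneg.mpr htS
      positivity
    nlinarith
  have h2 : 1 - a * q * e ≤ Real.exp (-(a * q * e)) := by
    linarith [Real.add_one_le_exp (-(a * q * e))]
  have h3 : 1 - a * S + a * t ≤ (1 - a * S) * Real.exp (L * t) := by
    have h4 : a * t ≤ (1 - a * S) * (L * t) := by
      have h5 : L * t * (1 - 2 * a) ≤ L * t * (1 - a * S) :=
        mul_le_mul_of_nonneg_left (by nlinarith) (by positivity)
      have h6 : a * t = L * (1 - 2 * a) * t := by rw [← hLa]
      linarith
    nlinarith [Real.add_one_le_exp (L * t)]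
  have h4 : 0 ≤ 1 - a * S + a * t := by positivity
  have h5 : 1 - a * (S - t + q * e) ≤
      (1 - a * S) * Real.exp (L * t) * Real.exp (-(a * q * e)) :=
    h1.trans ((mul_le_mul_of_nonneg_left h2 h4).trans
      (mul_le_mul_of_nonneg_right h3 (Real.exp_pos _).le))
  calc _ ≤ (1 - a * S) * Real.exp (L * t) * Real.exp (-(a * q * e)) *
        Real.exp (a * q * e - L * t) := by gcongr
    _ = 1 - a * S := by
      rw [mul_assoc, mul_assoc, ← Real.exp_add, ← Real.exp_add,
        show L * t + (-(a * q * e) + (a * q * e - L * t)) = 0 by ring, Real.exp_zero, mul_one]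

/-! ### Growth of the bet along a branch. -/

section Growth

variable {Ω I : Type*} {c : ℕ → Ω → I} {par : I → I} {D : ℕ → Set I} {h : ℕ → I → I}
  {b : ℝ} {m : ℕ}

open Classical in
-- When a hole expires its share is 0 or 1, so expiring shares count hits.
theorem holeShare_cell (hpar : ∀ n x, par (c (n + 1) x) = c n x) (i : ℕ) (x : Ω) :
    holeShare par D h b m i (i + m) (c (i + m) x) =
      if c i x ∈ D i ∧ c (i + m) x = h i (c i x) then 1 else 0 := by
  rw [holeShare, Nat.add_sub_cancel_left, iterate_parent hpar, Nat.sub_self, pow_zero,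
    Function.iterate_zero, id_eq]
  simp only [eq_comm]

theorem holeShare_le_refinedShare (hb : 0 ≤ b) (hm : 0 < m) {n : ℕ} (hmn : m ≤ n + 1) (v : I) :
    holeShare par D h b m (n + 1 - m) (n + 1) v ≤ refinedShare par D h b m n v := by
  have := Finset.single_le_sum (s := Finset.range (n + 1))
    (f := fun i => if n < i + m then holeShare par D h b m i (n + 1) v else 0)
    (fun i _ => by
      split_ifs
      · exact holeShare_nonneg hb _ _ _
      · exact le_rfl)
    (Finset.mem_range.mpr (show n + 1 - m < n + 1 by omega))
  rwa [if_pos (by omega)] at this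

open Classical in
-- The factor `1 - a * pendingShare` makes the product telescope: it cancels the denominator of the
-- next step, and `one_sub_le_mul_exp` compares what remains with the new factor. Holes are counted
-- up to level `n`, since that of level `n` is already open, but hits only for `i + m ≤ n`.
theorem betWeight_ge (hpar : ∀ n x, par (c (n + 1) x) = c n x) (hb : 2 ≤ b) (hm : 0 < m)
    (hD : ∀ n, ∀ u ∈ D n, par^[m] (h n u) = u) {a : ℝ} {w₀ : I → ℝ} (ha0 : 0 ≤ a)
    (ha1 : a < 1 / 2) (hw : ∀ u, 0 ≤ w₀ u) (n : ℕ) (x : Ω) :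
    w₀ (c 0 x) * b⁻¹ ^ n * (1 - a * pendingShare par D h b m n (c n x)) *
      Real.exp (a * b⁻¹ ^ m * ∑ i ∈ Finset.range (n + 1), (if c i x ∈ D i then (1 : ℝ) else 0) -
        a / (1 - 2 * a) * ∑ i ∈ Finset.range (n + 1 - m),
          (if c i x ∈ D i ∧ c (i + m) x = h i (c i x) then (1 : ℝ) else 0)) ≤
      betWeight par D h b m a w₀ n (c n x) := by
  have hb0 : 0 ≤ b := by linarith
  have hq : 0 ≤ b⁻¹ ^ m := by positivity
  induction n with
  | zero =>
    rw [show 0 + 1 - m = 0 by omega, Finset.sum_range_zero, zero_add, Finset.sum_range_one,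
      pow_zero, mul_one, mul_assoc]
    refine mul_le_of_le_one_right (hw _) ?_
    have h1 : pendingShare par D h b m 0 (c 0 x) =
        0 - 0 + b⁻¹ ^ m * (if c 0 x ∈ D 0 then 1 else 0) := by
      have : c 0 x ∈ D 0 → par^[m] (h 0 (c 0 x)) = c 0 x := hD _ _
      rw [pendingShare, zero_add, Finset.sum_range_one, if_pos (by omega), holeShare]
      by_cases h0 : c 0 x ∈ D 0 <;> simp [h0, this]
    rw [h1]
    refine (one_sub_le_mul_exp ha0 ha1 hq zero_le_two le_rfl le_rfl ?_).trans (by simp)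
    split_ifs <;> norm_num
  | succ n ih =>
    set t : ℝ := if m ≤ n + 1 then holeShare par D h b m (n + 1 - m) (n + 1) (c (n + 1) x) else 0
      with ht
    set e : ℝ := if c (n + 1) x ∈ D (n + 1) then 1 else 0 with he
    have hS : pendingShare par D h b m (n + 1) (c (n + 1) x) =
        refinedShare par D h b m n (c (n + 1) x) - t + b⁻¹ ^ m * e := by
      rw [pendingShare_succ hm hD, ht, he]
      simp
    have hsum : ∑ i ∈ Finset.range (n + 1 + 1 - m),
        (if c i x ∈ D i ∧ c (i + m) x = h i (c i x) then (1 : ℝ) else 0) =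
        ∑ i ∈ Finset.range (n + 1 - m),
        (if c i x ∈ D i ∧ c (i + m) x = h i (c i x) then (1 : ℝ) else 0) + t := by
      by_cases hmn : m ≤ n + 1
      · rw [show n + 1 + 1 - m = n + 1 - m + 1 by omega, Finset.sum_range_succ, ht, if_pos hmn,
          ← holeShare_cell (b := b) hpar, Nat.sub_add_cancel hmn]
      · rw [ht, if_neg hmn, show n + 1 + 1 - m = 0 by omega, show n + 1 - m = 0 by omega, add_zero]
    have ht0 : 0 ≤ t := by
      rw [ht]
      split_ifs
      · exact holeShare_nonneg hb0 _ _ _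
      · exact le_rfl
    have hR0 : 0 ≤ refinedShare par D h b m n (c (n + 1) x) :=
      Finset.sum_nonneg fun i _ => by
        split_ifs
        · exact holeShare_nonneg hb0 _ _ _
        · exact le_rfl
    have htS : t ≤ refinedShare par D h b m n (c (n + 1) x) := by
      rw [ht]
      split_ifs with hmn
      · exact holeShare_le_refinedShare hb0 hm hmn _
      · exact hR0
    have he0 : 0 ≤ e := by rw [he]; split_ifs <;> norm_num
    have hstep := one_sub_le_mul_exp ha0 ha1 hq
      (refinedShare_le_two (par := par) (D := D) (h := h) (m := m) hb n (c (n + 1) x)) ht0 htS he0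
    have hP := one_half_le_pending (par := par) (D := D) (h := h) (m := m) hb ha0 ha1 n (c n x)
    rw [hsum, Finset.sum_range_succ _ (n + 1), ← he, hS, betWeight, hpar]
    set N := ∑ i ∈ Finset.range (n + 1), (if c i x ∈ D i then (1 : ℝ) else 0)
    set H := ∑ i ∈ Finset.range (n + 1 - m),
        (if c i x ∈ D i ∧ c (i + m) x = h i (c i x) then (1 : ℝ) else 0)
    set P := 1 - a * pendingShare par D h b m n (c n x)
    set R := refinedShare par D h b m n (c (n + 1) x)
    set E := Real.exp (a * b⁻¹ ^ m * N - a / (1 - 2 * a) * H)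
    have hR : 0 ≤ 1 - a * R :=
      le_trans (by linarith)
        (refined_ge (par := par) (D := D) (h := h) (m := m) hb ha0 n (c (n + 1) x))
    calc w₀ (c 0 x) * b⁻¹ ^ (n + 1) * (1 - a * (R - t + b⁻¹ ^ m * e)) *
          Real.exp (a * b⁻¹ ^ m * (N + e) - a / (1 - 2 * a) * (H + t))
        = w₀ (c 0 x) * b⁻¹ ^ n * E * b⁻¹ * ((1 - a * (R - t + b⁻¹ ^ m * e)) *
          Real.exp (a * b⁻¹ ^ m * e - a / (1 - 2 * a) * t)) := by
          rw [show a * b⁻¹ ^ m * (N + e) - a / (1 - 2 * a) * (H + t) =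
            (a * b⁻¹ ^ m * N - a / (1 - 2 * a) * H) +
            (a * b⁻¹ ^ m * e - a / (1 - 2 * a) * t) by ring, Real.exp_add]
          ring
      _ ≤ w₀ (c 0 x) * b⁻¹ ^ n * E * b⁻¹ * (1 - a * R) := by
          have := hw (c 0 x)
          gcongr
      _ = (w₀ (c 0 x) * b⁻¹ ^ n * P * E) * (b⁻¹ * (1 - a * R) / P) := by
          have : P ≠ 0 := by linarith
          field_simp
      _ ≤ _ := by
          refine mul_le_mul_of_nonneg_right ih (div_nonneg (mul_nonneg (by positivity) hR) ?_)
          linarith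

open Classical in
theorem ae_eventually_cell_ge [MeasurableSpace Ω] {μ : Measure Ω} [Countable I]
    [MeasurableSpace I] [MeasurableSingletonClass I] [IsProbabilityMeasure μ]
    (hc : ∀ n, Measurable (c n)) (hpar : ∀ n x, par (c (n + 1) x) = c n x)
    {fib : I → Finset I} (hfib : ∀ u v, v ∈ fib u ↔ par v = u)
    (hcard : ∀ u, ((fib u).card : ℝ) = b) (hb : 2 ≤ b) (hm : 0 < m)
    (hD : ∀ n, ∀ u ∈ D n, par^[m] (h n u) = u) {p : ℝ} (hp0 : 0 ≤ p) (hp1 : p ≤ 1)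
    (hDμ : ∀ n, ∀ u ∈ D n, μ (c (n + m) ⁻¹' {h n u}) ≤ ENNReal.ofReal p * μ (c n ⁻¹' {u}))
    {a : ℝ} (ha0 : 0 ≤ a) (ha1 : a < 1 / 2) {δ : ℝ} (hδ : 0 < δ) :
    ∀ᵐ x ∂μ, ∀ᶠ n : ℕ in atTop,
      Real.exp (-(δ * n)) * b⁻¹ ^ n * Real.exp ((a * b⁻¹ ^ m - a / (1 - 2 * a) * p) *
        ∑ i ∈ Finset.range n, (if c i x ∈ D i then (1 : ℝ) else 0)) ≤
      μ.real (c n ⁻¹' {c n x}) := by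
  set L := a / (1 - 2 * a) with hL
  have hL0 : 0 ≤ L := div_nonneg ha0 (by linarith)
  have hb0 : 0 < b := by linarith
  -- One third of `δ` pays for the excess hits, one for comparing weights with `μ`, and one for the
  -- initial weight together with the factor `1 / 2`.
  set δ' := δ / (3 * (L + 1)) with hδ'
  have hδ'0 : 0 < δ' := by positivity
  have hLδ : L * δ' ≤ δ / 3 := by
    rw [hδ', ← mul_div_assoc, div_le_div_iff₀ (by positivity) (by positivity)]
    nlinarith
  have hw : ∀ u, 0 ≤ μ.real (c 0 ⁻¹' {u}) := fun u => measureReal_nonneg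
  have hW : ∀ n, ∑' u, ENNReal.ofReal
      (betWeight par D h b m a (fun u => μ.real (c 0 ⁻¹' {u})) n u) ≤ 1 := by
    intro n
    rw [tsum_betWeight hfib hcard hb ha0 ha1 hw]
    refine le_of_eq_of_le (tsum_congr fun u => ofReal_measureReal) (tsum_cell_le_one hc 0)
  filter_upwards [ae_eventually_weight_le (c := c) hW (div_pos hδ three_pos),
    ae_cell_pos (μ := μ) (c := c),
    ae_eventually_window_hits_le hc hpar hm hp0 hp1 hDμ hδ'0] with x hx hpos hhit
  have hlim : Tendsto (fun n : ℕ => Real.exp (-(δ / 3 * n))) atTop (𝓝 0) :=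
    Real.tendsto_exp_neg_atTop_nhds_zero.comp
      (tendsto_natCast_atTop_atTop.const_mul_atTop (div_pos hδ three_pos))
  have hinit := hlim.eventually (ge_mem_nhds (half_pos (hpos 0)))
  filter_upwards [hx, hhit, hinit] with n h1 h2 h3
  have h4 := (betWeight_ge hpar hb hm hD ha0 ha1 hw n x).trans h1
  set N := ∑ i ∈ Finset.range n, (if c i x ∈ D i then (1 : ℝ) else 0) with hN
  set N' := ∑ i ∈ Finset.range (n + 1), (if c i x ∈ D i then (1 : ℝ) else 0) with hN'
  set H := ∑ i ∈ Finset.range n,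
    (if c i x ∈ D i ∧ c (i + m) x = h i (c i x) then (1 : ℝ) else 0) with hH
  set H' := ∑ i ∈ Finset.range (n + 1 - m),
    (if c i x ∈ D i ∧ c (i + m) x = h i (c i x) then (1 : ℝ) else 0) with hH'
  have hNN : N ≤ N' := Finset.sum_le_sum_of_subset_of_nonneg (Finset.range_mono (by omega))
    fun i _ _ => by split_ifs <;> norm_num
  have hHH : H' ≤ H := Finset.sum_le_sum_of_subset_of_nonneg (Finset.range_mono (by omega))
    fun i _ _ => by split_ifs <;> norm_num
  have hP := one_half_le_pending (par := par) (D := D) (h := h) (m := m) hb ha0 ha1 n (c n x)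
  have hexp : (a * b⁻¹ ^ m - L * p) * N - δ / 3 * n ≤ a * b⁻¹ ^ m * N' - L * H' := by
    have e1 : a * b⁻¹ ^ m * N ≤ a * b⁻¹ ^ m * N' := by gcongr
    have e2 : L * H' ≤ L * (p * N + δ' * n) := mul_le_mul_of_nonneg_left (hHH.trans h2) hL0
    have e3 : L * δ' * n ≤ δ / 3 * n := by gcongr
    linarith
  have h5 : Real.exp (-(δ / 3 * n)) * b⁻¹ ^ n *
      Real.exp ((a * b⁻¹ ^ m - L * p) * N - δ / 3 * n) ≤
      Real.exp (δ / 3 * n) * μ.real (c n ⁻¹' {c n x}) := by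
    refine le_trans ?_ h4
    have e1 : Real.exp (-(δ / 3 * n)) ≤ μ.real (c 0 ⁻¹' {c 0 x}) *
        (1 - a * pendingShare par D h b m n (c n x)) := by
      have := mul_le_mul_of_nonneg_left hP (hpos 0).le
      have h3' : Real.exp (-(δ / 3 * n)) ≤ μ.real (c 0 ⁻¹' {c 0 x}) / 2 := h3
      linarith
    calc _ ≤ μ.real (c 0 ⁻¹' {c 0 x}) * (1 - a * pendingShare par D h b m n (c n x)) * b⁻¹ ^ n *
          Real.exp (a * b⁻¹ ^ m * N' - L * H') := by
          gcongr
      _ = _ := by ring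
  calc _ = Real.exp (-(δ / 3 * n)) * (Real.exp (-(δ / 3 * n)) * b⁻¹ ^ n *
        Real.exp ((a * b⁻¹ ^ m - L * p) * N - δ / 3 * n)) := by
        rw [show (a * b⁻¹ ^ m - L * p) * N - δ / 3 * n =
          -(δ / 3 * n) + (a * b⁻¹ ^ m - L * p) * N by ring,
          show -(δ * n) = -(δ / 3 * n) + -(δ / 3 * n) + -(δ / 3 * n) by ring,
          Real.exp_add, Real.exp_add, Real.exp_add]
        ring
    _ ≤ Real.exp (-(δ / 3 * n)) * (Real.exp (δ / 3 * n) * μ.real (c n ⁻¹' {c n x})) := by gcongr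
    _ = _ := by rw [← mul_assoc, ← Real.exp_add]; simp

end Growth

/-! ### Translated dyadic grids. -/

section Grid

variable {d : ℕ}

/-- The index of the cell of side `κ / 2 ^ n` containing `x` in the dyadic grid translated by
`κ θ / N`. -/
noncomputable def gridCell (κ : ℝ) {N : ℕ} (θ : Fin d → ZMod N) (n : ℕ)
    (x : EuclideanSpace ℝ (Fin d)) : Fin d → ℤ :=
  fun j => ⌊(x j / κ - (θ j).val / N) * 2 ^ n⌋

/-- The index of the parent of a dyadic cell. -/
def cellParent (u : Fin d → ℤ) : Fin d → ℤ := fun j => u j / 2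

/-- The indices of the children of a dyadic cell. -/
def cellChildren (u : Fin d → ℤ) : Finset (Fin d → ℤ) :=
  Fintype.piFinset fun j => {2 * u j, 2 * u j + 1}

theorem mem_cellChildren (u v : Fin d → ℤ) : v ∈ cellChildren u ↔ cellParent v = u := by
  rw [cellChildren, Fintype.mem_piFinset, funext_iff]
  refine forall_congr' fun j => ?_
  simp only [Finset.mem_insert, Finset.mem_singleton, cellParent]
  omega

theorem card_cellChildren (u : Fin d → ℤ) : (cellChildren u).card = 2 ^ d := by
  rw [cellChildren, Fintype.card_piFinset]
  simp

variable {κ : ℝ} {N : ℕ} {θ : Fin d → ZMod N}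

theorem measurable_gridCell (n : ℕ) : Measurable (gridCell κ θ n) := by
  refine measurable_pi_lambda _ fun j => Int.measurable_floor.comp ?_
  fun_prop

theorem cellParent_gridCell (n : ℕ) (x : EuclideanSpace ℝ (Fin d)) :
    cellParent (gridCell κ θ (n + 1) x) = gridCell κ θ n x := by
  funext j
  simp only [cellParent, gridCell]
  rw [show ((2 : ℤ)) = ((2 : ℕ) : ℤ) by rfl, ← Int.floor_div_natCast, pow_succ]
  congr 1
  push_cast
  ring

theorem dist_le_of_gridCell_eq (hκ : 0 < κ) {n : ℕ} {x y : EuclideanSpace ℝ (Fin d)}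
    (h : gridCell κ θ n x = gridCell κ θ n y) : dist x y ≤ √d * (κ / 2 ^ n) := by
  rw [EuclideanSpace.dist_eq]
  have hcoord : ∀ j, dist (x j) (y j) ≤ κ / 2 ^ n := by
    intro j
    have h1 := Int.abs_sub_lt_one_of_floor_eq_floor (congrFun h j)
    rw [← sub_mul, sub_sub_sub_cancel_right, ← sub_div, abs_mul, abs_div, abs_of_pos hκ,
      abs_of_pos (by positivity : (0 : ℝ) < 2 ^ n), div_mul_eq_mul_div, div_lt_one hκ] at h1
    rw [Real.dist_eq, le_div_iff₀ (by positivity)]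
    exact h1.le
  calc √(∑ j, dist (x j) (y j) ^ 2) ≤ √(∑ _j : Fin d, (κ / 2 ^ n) ^ 2) := by
        gcongr with j
        exact hcoord j
    _ = √d * (κ / 2 ^ n) := by
        rw [Finset.sum_const, Finset.card_univ, Fintype.card_fin, nsmul_eq_mul,
          Real.sqrt_mul (Nat.cast_nonneg _), Real.sqrt_sq (by positivity)]

/-- Measured in sides of the cell, the radius of the ball is `κ⁻¹`. -/
theorem closedBall_subset_gridCell (hκ : 0 < κ) {n : ℕ} {x : EuclideanSpace ℝ (Fin d)}
    (h : ∀ j, κ⁻¹ ≤ Int.fract ((x j / κ - (θ j).val / N) * 2 ^ n) ∧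
      Int.fract ((x j / κ - (θ j).val / N) * 2 ^ n) < 1 - κ⁻¹) :
    Metric.closedBall x (2⁻¹ ^ n) ⊆ gridCell κ θ n ⁻¹' {gridCell κ θ n x} := by
  intro y hy
  rw [Metric.mem_closedBall, dist_eq_norm] at hy
  funext j
  obtain ⟨h1, h2⟩ := h j
  simp only [gridCell]
  set z := (x j / κ - (θ j).val / N) * 2 ^ n
  have h3 : |y j - x j| ≤ 2⁻¹ ^ n := (PiLp.norm_apply_le (y - x) j).trans hy
  have h4 : |(y j / κ - (θ j).val / N) * 2 ^ n - z| ≤ κ⁻¹ := by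
    rw [← sub_mul, sub_sub_sub_cancel_right, ← sub_div, abs_mul, abs_div, abs_of_pos hκ,
      abs_of_pos (by positivity : (0 : ℝ) < 2 ^ n)]
    calc |y j - x j| / κ * 2 ^ n ≤ 2⁻¹ ^ n / κ * 2 ^ n := by gcongr
      _ = κ⁻¹ := by rw [inv_pow]; field_simp
  rw [abs_le] at h4
  have h5 := Int.fract_add_floor z
  rw [Int.floor_eq_iff]
  constructor <;> linarith

/-- As `N` is odd, multiplication by `2 ^ n` permutes `ZMod N`: at every level the shifts are
equally spaced modulo the side. It remains to count integers in an interval of length `N (B - A)`.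
-/
theorem card_fract_mem_ge [NeZero N] (hN : Odd N) (n : ℕ) (z : ℝ) {A B : ℝ} (hA : 0 ≤ A)
    (hB : B ≤ 1) :
    N * (B - A) - 1 ≤ ((Finset.univ.filter fun t : ZMod N =>
      A ≤ Int.fract (z - t.val / N * 2 ^ n) ∧ Int.fract (z - t.val / N * 2 ^ n) < B).card : ℝ) := by
  have hN0 : (0 : ℝ) < N := by exact_mod_cast Nat.pos_of_ne_zero (NeZero.ne N)
  have hu : Nat.Coprime (2 ^ n) N := Nat.Coprime.pow_left _ (Nat.coprime_two_left.mpr hN)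
  set w : (ZMod N)ˣ := ZMod.unitOfCoprime _ hu with hw
  set J := Finset.Ioc ⌊N * (z - B)⌋ ⌊N * (z - A)⌋ with hJ
  have hmem : ∀ k ∈ J, N * (z - B) < k ∧ k ≤ N * (z - A) := by
    intro k hk
    rw [hJ, Finset.mem_Ioc] at hk
    exact ⟨Int.floor_lt.mp hk.1, Int.le_floor.mp hk.2⟩
  have hcard : J.card ≤ (Finset.univ.filter fun t : ZMod N =>
      A ≤ Int.fract (z - t.val / N * 2 ^ n) ∧ Int.fract (z - t.val / N * 2 ^ n) < B).card := by
    refine Finset.card_le_card_of_injOn (fun k => (w⁻¹ : (ZMod N)ˣ) * (k : ZMod N)) ?_ ?_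
    · intro k hk
      obtain ⟨h1, h2⟩ := hmem k hk
      set t : ZMod N := (w⁻¹ : (ZMod N)ˣ) * (k : ZMod N) with ht
      have h3 : (N : ℤ) ∣ 2 ^ n * t.val - k := by
        rw [← ZMod.intCast_zmod_eq_zero_iff_dvd]
        have : ((2 : ZMod N) ^ n) = w := by rw [hw, ZMod.coe_unitOfCoprime]; push_cast; rfl
        push_cast
        rw [ZMod.natCast_zmod_val, this, ht, Units.mul_inv_cancel_left, sub_self]
      obtain ⟨l, hl⟩ := h3
      have h4 : (2 : ℝ) ^ n * t.val = k + N * l := by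
        have : ((2 ^ n * t.val - k : ℤ) : ℝ) = (N * l : ℤ) := by rw [hl]
        push_cast at this
        linarith
      have h5 : z - t.val / N * 2 ^ n = (z - k / N) - l := by
        rw [div_mul_eq_mul_div, mul_comm _ ((2 : ℝ) ^ n), h4]
        field_simp
        ring
      have h6 : A ≤ z - k / N := by
        rw [le_sub_comm, div_le_iff₀ hN0]; linarith
      have h7 : z - k / N < B := by
        rw [sub_lt_comm, lt_div_iff₀ hN0]; linarith
      have h8 : Int.fract (z - t.val / N * 2 ^ n) = z - k / N := by
        rw [h5, Int.fract_sub_intCast, Int.fract_eq_self]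
        exact ⟨hA.trans h6, h7.trans_le hB⟩
      rw [Finset.mem_coe, Finset.mem_filter, h8]
      exact ⟨Finset.mem_univ _, h6, h7⟩
    -- `J` lies in a half-open interval of length at most `N`, so congruent members are equal.
    · intro k hk k' hk' hkk
      have h1 : (k : ZMod N) = k' := (Units.mul_right_inj _).mp hkk
      rw [← sub_eq_zero, ← Int.cast_sub, ZMod.intCast_zmod_eq_zero_iff_dvd] at h1
      obtain ⟨h2, h3⟩ := hmem k hk
      obtain ⟨h4, h5⟩ := hmem k' hk'
      have h6 : |k - k'| < (N : ℤ) := by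
        have : |((k - k' : ℤ) : ℝ)| < N := by
          push_cast
          rw [abs_lt]
          constructor <;> nlinarith
        exact_mod_cast this
      linarith [Int.eq_zero_of_abs_lt_dvd h1 h6]
  have h1 : ((⌊N * (z - A)⌋ - ⌊N * (z - B)⌋ : ℤ) : ℝ) ≤ J.card := by
    rw [hJ, Int.card_Ioc]
    exact_mod_cast Int.self_le_toNat _
  have h2 := Int.lt_floor_add_one (N * (z - A))
  have h3 := Int.floor_le (N * (z - B))
  refine le_trans ?_ (Nat.cast_le.mpr hcard)
  push_cast at h1
  linarith

theorem card_centered_shift_ge [NeZero N] (hN : Odd N) (hκ : 0 < κ)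
    (hκN : 0 ≤ 1 - 2 / κ - 1 / N) (n : ℕ) (x : EuclideanSpace ℝ (Fin d)) :
    (1 - 2 / κ - 1 / N) ^ d * N ^ d ≤ ((Finset.univ.filter fun θ : Fin d → ZMod N =>
      ∀ j, κ⁻¹ ≤ Int.fract ((x j / κ - (θ j).val / N) * 2 ^ n) ∧
        Int.fract ((x j / κ - (θ j).val / N) * 2 ^ n) < 1 - κ⁻¹).card : ℝ) := by
  have hN0 : (0 : ℝ) < N := by exact_mod_cast Nat.pos_of_ne_zero (NeZero.ne N)
  have h1 : (Finset.univ.filter fun θ : Fin d → ZMod N =>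
      ∀ j, κ⁻¹ ≤ Int.fract ((x j / κ - (θ j).val / N) * 2 ^ n) ∧
        Int.fract ((x j / κ - (θ j).val / N) * 2 ^ n) < 1 - κ⁻¹) =
      Fintype.piFinset fun j => Finset.univ.filter fun t : ZMod N =>
        κ⁻¹ ≤ Int.fract ((x j / κ) * 2 ^ n - t.val / N * 2 ^ n) ∧
        Int.fract ((x j / κ) * 2 ^ n - t.val / N * 2 ^ n) < 1 - κ⁻¹ := by
    ext θ
    simp [Fintype.mem_piFinset, sub_mul]
  rw [h1, Fintype.card_piFinset, ← mul_pow]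
  push_cast
  calc ((1 - 2 / κ - 1 / N) * N) ^ d = ∏ _j : Fin d, ((1 - 2 / κ - 1 / N) * N) := by simp
    _ ≤ _ := by
      refine Finset.prod_le_prod (fun j _ => by positivity) fun j _ => ?_
      refine le_trans (le_of_eq ?_) (card_fract_mem_ge hN n (x j / κ * 2 ^ n)
        (inv_nonneg.mpr hκ.le) (sub_le_self _ (inv_nonneg.mpr hκ.le)))
      field_simp
      ring

/-- A cell `m` levels deeper has diameter below the radius of the nearly empty ball, so the cell
containing the centre of that ball is the hole. -/
theorem exists_gridCell_hole {μ : Measure (EuclideanSpace ℝ (Fin d))} [IsFiniteMeasure μ]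
    (hκ : 0 < κ) {m n : ℕ} {x : EuclideanSpace ℝ (Fin d)} {α ε p : ℝ} (hα : √d * (κ / 2 ^ m) < α)
    (hεp : ε < p) (hp : 0 < p) (hpor : α ≤ porosity μ x (2⁻¹ ^ n) ε)
    (hx : Metric.closedBall x (2⁻¹ ^ n) ⊆ gridCell κ θ n ⁻¹' {gridCell κ θ n x}) :
    ∃ h, cellParent^[m] h = gridCell κ θ n x ∧
      μ (gridCell κ θ (n + m) ⁻¹' {h}) ≤
        ENNReal.ofReal p * μ (gridCell κ θ n ⁻¹' {gridCell κ θ n x}) := by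
  have hα0 : 0 < α := lt_of_le_of_lt (by positivity) hα
  have hlt := hα.trans_le hpor
  rw [porosity] at hlt
  -- The supremum of the empty set is 0 in `ℝ`, which a positive lower bound excludes.
  obtain ⟨s, ⟨hs0, hs⟩, hsα⟩ := exists_lt_of_lt_csSup (by
    by_contra hne
    rw [Set.not_nonempty_iff_eq_empty] at hne
    rw [hne, Real.sSup_empty] at hlt
    exact absurd hlt (not_lt.mpr (by positivity))) hlt
  -- The infimum need not be attained; the strict inequality `ε < p` provides an actual ball.
  have hs' := hs.trans_lt ((ENNReal.ofReal_lt_ofReal_iff hp).mpr hεp)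
  simp only [iInf_lt_iff] at hs'
  obtain ⟨y, hy, hlt'⟩ := hs'
  have hyx : y ∈ Metric.closedBall x (2⁻¹ ^ n) :=
    hy (Metric.mem_closedBall_self (by positivity))
  refine ⟨gridCell κ θ (n + m) y, ?_, ?_⟩
  · rw [iterate_parent cellParent_gridCell]
    exact hx hyx
  · have h1 : gridCell κ θ (n + m) ⁻¹' {gridCell κ θ (n + m) y} ⊆
        Metric.closedBall y (s * 2⁻¹ ^ n) := by
      intro z hz
      rw [Metric.mem_closedBall]
      refine (dist_le_of_gridCell_eq hκ hz).trans ?_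
      rw [pow_add, inv_pow, mul_comm ((2 : ℝ) ^ n), ← div_div, div_eq_mul_inv (κ / 2 ^ m),
        ← mul_assoc]
      gcongr
    calc μ (gridCell κ θ (n + m) ⁻¹' {gridCell κ θ (n + m) y})
        ≤ μ (Metric.closedBall y (s * 2⁻¹ ^ n)) := measure_mono h1
      _ ≤ ENNReal.ofReal p * μ (Metric.closedBall x (2⁻¹ ^ n)) := by
        by_cases h0 : μ (Metric.closedBall x (2⁻¹ ^ n)) = 0
        · rw [measure_mono_null hy h0]
          exact zero_le
        · exact (ENNReal.div_le_iff h0 (measure_ne_top _ _)).mp hlt'.le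
      _ ≤ _ := by gcongr

end Grid

/-! ### From cells to balls and to the packing dimension. -/

section Dimension

variable {d : ℕ}

open Classical in
theorem MeanPorous.ae_eventually_count_ge {μ : Measure (EuclideanSpace ℝ (Fin d))} {α η ε : ℝ}
    (h : MeanPorous μ α η ε) {δ : ℝ} (hδ : 0 < δ) :
    ∀ᵐ x ∂μ, ∀ᶠ n : ℕ in atTop, (η - δ) * n ≤
      ∑ i ∈ Finset.range n, (if α ≤ porosity μ x (2⁻¹ ^ i) ε then (1 : ℝ) else 0) := by
  filter_upwards [h] with x hx
  have hlt := lt_of_lt_of_le (sub_lt_self η hδ) hx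
  have hev := eventually_lt_of_lt_liminf hlt
    (isBoundedUnder_of ⟨0, fun n => by positivity⟩)
  filter_upwards [hev, eventually_gt_atTop 0] with n hn hn0
  have hn0' : (0 : ℝ) < n := by exact_mod_cast hn0
  have hcount : (Set.ncard {i : ℕ | i < n ∧ α ≤ porosity μ x ((2 : ℝ)⁻¹ ^ i) ε} : ℝ) =
      ∑ i ∈ Finset.range n, (if α ≤ porosity μ x (2⁻¹ ^ i) ε then (1 : ℝ) else 0) := by
    rw [Finset.sum_boole, ← Set.ncard_coe_finset]
    congr 3
    ext i
    simp
  rw [hcount, one_div, inv_mul_eq_div, lt_div_iff₀ hn0'] at hn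
  exact hn.le

open Classical in
/-- Some translated grid sees at least the average proportion of the marked scales. -/
theorem exists_shift_count_ge {κ : ℝ} {N : ℕ} [NeZero N] (hN : Odd N) (hκ : 0 < κ)
    (hκN : 0 ≤ 1 - 2 / κ - 1 / N) (x : EuclideanSpace ℝ (Fin d)) (P : ℕ → Prop)
    (Q : (Fin d → ZMod N) → ℕ → Prop)
    (hQ : ∀ θ i, P i → (∀ j, κ⁻¹ ≤ Int.fract ((x j / κ - (θ j).val / N) * 2 ^ i) ∧
        Int.fract ((x j / κ - (θ j).val / N) * 2 ^ i) < 1 - κ⁻¹) → Q θ i) (n : ℕ) :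
    ∃ θ, (1 - 2 / κ - 1 / N) ^ d * ∑ i ∈ Finset.range n, (if P i then (1 : ℝ) else 0) ≤
      ∑ i ∈ Finset.range n, (if Q θ i then (1 : ℝ) else 0) := by
  set ρ : ℝ := (1 - 2 / κ - 1 / N) ^ d
  have hsum : ∑ _θ : Fin d → ZMod N,
      ρ * ∑ i ∈ Finset.range n, (if P i then (1 : ℝ) else 0) ≤
      ∑ θ : Fin d → ZMod N, ∑ i ∈ Finset.range n, (if Q θ i then (1 : ℝ) else 0) := by
    -- With the sums exchanged, each marked scale is seen by at least `ρ * N ^ d` of the `N ^ d`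
    -- shifts.
    rw [Finset.sum_comm, Finset.sum_const, Finset.card_univ, Fintype.card_pi, Finset.mul_sum,
      Finset.smul_sum]
    refine Finset.sum_le_sum fun i _ => ?_
    rw [nsmul_eq_mul, Finset.sum_boole]
    split_ifs with hi
    · simp only [ZMod.card, Finset.prod_const, Finset.card_univ, Fintype.card_fin, mul_one,
        Nat.cast_pow]
      rw [mul_comm]
      refine (card_centered_shift_ge hN hκ hκN i x).trans (Nat.cast_le.mpr ?_)
      refine Finset.card_le_card fun θ hθ => ?_
      rw [Finset.mem_filter] at hθ ⊢
      exact ⟨hθ.1, hQ θ i hi hθ.2⟩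
    · simp
  obtain ⟨θ, -, hθ⟩ := Finset.exists_le_of_sum_le Finset.univ_nonempty hsum
  exact ⟨θ, hθ⟩

/-- There are finitely many grids, so the growth bound eventually holds for all of them at once and
the favourable shift may depend on `n`. -/
theorem MeanPorous.ae_eventually_closedBall_ge {μ : Measure (EuclideanSpace ℝ (Fin d))}
    [IsProbabilityMeasure μ] (hd : 1 ≤ d) {α η ε : ℝ} (h : MeanPorous μ α η ε)
    (hε0 : 0 ≤ ε) (hε1 : ε < 1) {κ : ℝ} {N m : ℕ} (hN : Odd N) (hκ : 0 < κ)
    (hκN : 0 ≤ 1 - 2 / κ - 1 / N) (hm : 0 < m) (hα : √d * (κ / 2 ^ m) < α) {a : ℝ} (ha0 : 0 ≤ a)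
    (ha1 : a < 1 / 2) (hgain : 0 ≤ a * ((2 ^ d)⁻¹ ^ m) - a / (1 - 2 * a) * ε)
    {δ : ℝ} (hδ : 0 < δ) :
    ∀ᵐ x ∂μ, ∀ᶠ n : ℕ in atTop,
      Real.exp (-((d * Real.log 2 - η * ((1 - 2 / κ - 1 / N) ^ d *
        (a * ((2 ^ d)⁻¹ ^ m) - a / (1 - 2 * a) * ε)) + δ) * n)) ≤
        μ.real (Metric.closedBall x (√d * κ / 2 ^ n)) := by
  classical
  have : NeZero N := ⟨hN.pos.ne'⟩
  set g := a * ((2 ^ d)⁻¹ ^ m) - a / (1 - 2 * a) * ε with hg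
  set ρ : ℝ := (1 - 2 / κ - 1 / N) ^ d with hρ
  set L := a / (1 - 2 * a) with hL
  have hL0 : 0 ≤ L := div_nonneg ha0 (by linarith)
  have hρ0 : 0 ≤ ρ := by positivity
  -- `p` must exceed `ε` and stay at most 1, while costing at most `δ / 3` per hole.
  set p := ε + min (1 - ε) (δ / (3 * (L + 1))) with hp
  have hmin : 0 < min (1 - ε) (δ / (3 * (L + 1))) := lt_min (by linarith) (by positivity)
  have hp0 : 0 < p := by linarith
  have hp1 : p ≤ 1 := by linarith [min_le_left (1 - ε) (δ / (3 * (L + 1)))]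
  have hLp : L * p ≤ L * ε + δ / 3 := by
    have h1 : L * (δ / (3 * (L + 1))) ≤ δ / 3 := by
      rw [← mul_div_assoc, div_le_div_iff₀ (by positivity) (by positivity)]
      nlinarith
    have h2 := mul_le_mul_of_nonneg_left (min_le_right (1 - ε) (δ / (3 * (L + 1)))) hL0
    rw [hp, mul_add]
    linarith
  set D : (Fin d → ZMod N) → ℕ → Set (Fin d → ℤ) := fun θ n => {u | ∃ h, cellParent^[m] h = u ∧
    μ (gridCell κ θ (n + m) ⁻¹' {h}) ≤ ENNReal.ofReal p * μ (gridCell κ θ n ⁻¹' {u})} with hD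
  have hchoice : ∀ θ n u, ∃ h, u ∈ D θ n → cellParent^[m] h = u ∧
      μ (gridCell κ θ (n + m) ⁻¹' {h}) ≤ ENNReal.ofReal p * μ (gridCell κ θ n ⁻¹' {u}) := by
    intro θ n u
    by_cases hu : u ∈ D θ n
    · obtain ⟨h, hh⟩ := hu
      exact ⟨h, fun _ => hh⟩
    · exact ⟨u, fun h => absurd h hu⟩
  choose hole hhole using hchoice
  have hgrow : ∀ θ : Fin d → ZMod N, ∀ᵐ x ∂μ, ∀ᶠ n : ℕ in atTop,
      Real.exp (-(δ / 3 * n)) * (2 ^ d : ℝ)⁻¹ ^ n * Real.exp ((a * (2 ^ d : ℝ)⁻¹ ^ m - L * p) *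
        ∑ i ∈ Finset.range n, (if gridCell κ θ i x ∈ D θ i then (1 : ℝ) else 0)) ≤
      μ.real (gridCell κ θ n ⁻¹' {gridCell κ θ n x}) := fun θ =>
    ae_eventually_cell_ge (c := gridCell κ θ) (fun n => measurable_gridCell n)
      (fun n x => cellParent_gridCell n x) (fib := cellChildren) mem_cellChildren
      (fun u => by rw [card_cellChildren]; push_cast; rfl)
      (by simpa using pow_le_pow_right₀ (one_le_two : (1 : ℝ) ≤ 2) hd) hm
      (fun n u hu => (hhole θ n u hu).1) hp0.le hp1 (fun n u hu => (hhole θ n u hu).2) ha0 ha1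
      (by positivity)
  have hcount := h.ae_eventually_count_ge (δ := δ / (3 * (g * ρ + 1))) (by positivity)
  filter_upwards [ae_all_iff.mpr hgrow, hcount] with x hx hcx
  filter_upwards [eventually_all.mpr hx, hcx] with n hn hcn
  obtain ⟨θ, hθ⟩ := exists_shift_count_ge hN hκ hκN x
    (fun i => α ≤ porosity μ x (2⁻¹ ^ i) ε) (fun θ i => gridCell κ θ i x ∈ D θ i)
    (fun θ i hi hgood => exists_gridCell_hole hκ hα (by linarith) hp0 hi
      (closedBall_subset_gridCell hκ hgood)) n
  have hcell : μ.real (gridCell κ θ n ⁻¹' {gridCell κ θ n x}) ≤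
      μ.real (Metric.closedBall x (√d * κ / 2 ^ n)) := by
    refine measureReal_mono fun y hy => ?_
    rw [Metric.mem_closedBall, mul_div_assoc]
    exact dist_le_of_gridCell_eq hκ hy
  refine le_trans ?_ ((hn θ).trans hcell)
  set C := ∑ i ∈ Finset.range n, (if gridCell κ θ i x ∈ D θ i then (1 : ℝ) else 0) with hC
  set C' := ∑ i ∈ Finset.range n, (if α ≤ porosity μ x (2⁻¹ ^ i) ε then (1 : ℝ) else 0) with hC'
  have hCn : C ≤ n := by
    calc C ≤ ∑ _i ∈ Finset.range n, (1 : ℝ) :=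
          Finset.sum_le_sum fun i _ => by split_ifs <;> norm_num
      _ = n := by simp
  have hC0 : 0 ≤ C := Finset.sum_nonneg fun i _ => by split_ifs <;> norm_num
  have hpow : (2 ^ d : ℝ)⁻¹ ^ n = Real.exp (-(d * Real.log 2 * n)) := by
    rw [Real.exp_neg, inv_pow, mul_comm, Real.exp_nat_mul, Real.exp_nat_mul,
      Real.exp_log two_pos]
  rw [hpow, ← Real.exp_add, ← Real.exp_add, Real.exp_le_exp]
  have e1 : g * C - δ / 3 * n ≤ (a * (2 ^ d : ℝ)⁻¹ ^ m - L * p) * C := by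
    have h1 : (L * p - L * ε) * C ≤ δ / 3 * C := mul_le_mul_of_nonneg_right (by linarith) hC0
    have h2 : δ / 3 * C ≤ δ / 3 * n := by gcongr
    rw [hg]
    linarith
  have e2 : g * (ρ * ((η - δ / (3 * (g * ρ + 1))) * n)) ≤ g * C :=
    mul_le_mul_of_nonneg_left ((mul_le_mul_of_nonneg_left hcn hρ0).trans hθ) hgain
  have e3 : g * ρ * (δ / (3 * (g * ρ + 1))) * n ≤ δ / 3 * n := by
    gcongr
    rw [← mul_div_assoc, div_le_div_iff₀ (by positivity) (by positivity)]
    nlinarith [mul_nonneg hgain hρ0]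
  linarith

/-- Passing from the radii `R / 2 ^ n` to all radii changes `n` by a bounded amount, which the
margin in `s'` absorbs as `r → 0`. -/
theorem upperLocalDim_le {μ : Measure (EuclideanSpace ℝ (Fin d))} [IsFiniteMeasure μ]
    {x : EuclideanSpace ℝ (Fin d)} {R s : ℝ} (hR : 0 < R)
    (h : ∀ᶠ n : ℕ in atTop, Real.exp (-(s * n)) ≤ μ.real (Metric.closedBall x (R / 2 ^ n)))
    {s' : ℝ} (hs : s / Real.log 2 < s') : upperLocalDim μ x ≤ (s' : EReal) := by
  have hlog2 : 0 < Real.log 2 := Real.log_pos one_lt_two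
  rw [upperLocalDim]
  refine limsup_le_of_le (h := ?_)
  have hlog : Tendsto (fun r : ℝ => -Real.log r) (𝓝[>] 0) atTop :=
    tendsto_neg_atBot_atTop.comp Real.tendsto_log_nhdsGT_zero
  set n : ℝ → ℕ := fun r => ⌈(Real.log R - Real.log r) / Real.log 2⌉₊ with hn
  have hntop : Tendsto n (𝓝[>] 0) atTop :=
    tendsto_nat_ceil_atTop.comp
      ((tendsto_atTop_add_const_left _ (Real.log R) hlog).atTop_div_const hlog2)
  have hs0 : 0 < s' - s / Real.log 2 := by linarith
  have hbig := hlog.eventually (eventually_ge_atTop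
    (max (max 1 (-Real.log R)) ((|s| * (|Real.log R| / Real.log 2 + 1)) / (s' - s / Real.log 2))))
  filter_upwards [hntop.eventually h, hbig, self_mem_nhdsWithin] with r hr hrbig hr0
  have hr0' : (0 : ℝ) < r := hr0
  have hl1 : 1 ≤ -Real.log r := ((le_max_left _ _).trans (le_max_left _ _)).trans hrbig
  have hl2 : -Real.log R ≤ -Real.log r := ((le_max_right _ _).trans (le_max_left _ _)).trans hrbig
  have hl3 := (le_max_right _ _).trans hrbig
  rw [div_le_iff₀ hs0] at hl3
  set q := (Real.log R - Real.log r) / Real.log 2 with hq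
  have hq1 : q ≤ n r := Nat.le_ceil _
  have hq2 : (n r : ℝ) < q + 1 :=
    Nat.ceil_lt_add_one (div_nonneg (by linarith) hlog2.le)
  have hrad : R / 2 ^ n r ≤ r := by
    rw [← Real.log_le_log_iff (by positivity) hr0', Real.log_div hR.ne' (by positivity),
      Real.log_pow]
    rw [hq, div_le_iff₀ hlog2] at hq1
    linarith
  have hball : Real.exp (-(s * n r)) ≤ μ.real (Metric.closedBall x r) :=
    hr.trans (measureReal_mono (Metric.closedBall_subset_closedBall hrad))
  have hqeq : q = Real.log R / Real.log 2 + -Real.log r / Real.log 2 := by rw [hq]; ring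
  have hdiff : |n r - -Real.log r / Real.log 2| ≤ |Real.log R| / Real.log 2 + 1 := by
    have h1 : |Real.log R / Real.log 2| = |Real.log R| / Real.log 2 := by
      rw [abs_div, abs_of_pos hlog2]
    have h2 := neg_abs_le (Real.log R / Real.log 2)
    have h3 := le_abs_self (Real.log R / Real.log 2)
    rw [abs_le]
    constructor <;> linarith
  have hsn : s * n r ≤ s' * -Real.log r := by
    have h1 : s * (n r - -Real.log r / Real.log 2) ≤
        |s| * (|Real.log R| / Real.log 2 + 1) := by
      refine (le_abs_self _).trans ?_
      rw [abs_mul]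
      gcongr
    have h2 : s * (-Real.log r / Real.log 2) = s / Real.log 2 * -Real.log r := by ring
    linarith
  have hM : 0 < μ.real (Metric.closedBall x r) := (Real.exp_pos _).trans_le hball
  have hlogM : s' * Real.log r ≤ Real.log (μ.real (Metric.closedBall x r)) := by
    rw [Real.le_log_iff_exp_le hM]
    exact le_trans (Real.exp_le_exp.mpr (by linarith)) hball
  rw [← ofReal_measureReal (μ := μ) (s := Metric.closedBall x r), ENNReal.log_ofReal,
    if_neg hM.not_ge, ← EReal.coe_div, EReal.coe_le_coe_iff, div_le_iff_of_neg (by linarith)]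
  exact hlogM

theorem MeanPorous.packingDim_le {μ : Measure (EuclideanSpace ℝ (Fin d))}
    [IsProbabilityMeasure μ] (hd : 1 ≤ d) {α η ε : ℝ} (h : MeanPorous μ α η ε)
    (hε0 : 0 ≤ ε) (hε1 : ε < 1) {κ : ℝ} {N m : ℕ} (hN : Odd N) (hκ : 0 < κ)
    (hκN : 0 ≤ 1 - 2 / κ - 1 / N) (hm : 0 < m) (hα : √d * (κ / 2 ^ m) < α) {a : ℝ} (ha0 : 0 ≤ a)
    (ha1 : a < 1 / 2) (hgain : 0 ≤ a * ((2 ^ d)⁻¹ ^ m) - a / (1 - 2 * a) * ε) :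
    packingDim μ ≤ ((d - η * ((1 - 2 / κ - 1 / N) ^ d *
      (a * ((2 ^ d)⁻¹ ^ m) - a / (1 - 2 * a) * ε) / Real.log 2) : ℝ) : EReal) := by
  have hlog2 : 0 < Real.log 2 := Real.log_pos one_lt_two
  have hd0 : (0 : ℝ) < d := by exact_mod_cast hd
  rw [← EReal.le_of_forall_lt_iff_le]
  intro z hz
  rw [EReal.coe_lt_coe_iff] at hz
  set G := (1 - 2 / κ - 1 / N) ^ d * (a * ((2 ^ d)⁻¹ ^ m) - a / (1 - 2 * a) * ε) with hG
  set δ := (z - (d - η * (G / Real.log 2))) * Real.log 2 / 2 with hδ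
  have hδ0 : 0 < δ := by
    have := sub_pos.mpr hz
    positivity
  refine essSup_le_of_ae_le _ ?_
  filter_upwards [h.ae_eventually_closedBall_ge hd hε0 hε1 hN hκ hκN hm hα ha0 ha1 hgain hδ0]
    with x hx
  refine upperLocalDim_le (by positivity : 0 < √d * κ) hx ?_
  rw [div_lt_iff₀ hlog2]
  have h1 : (d - η * (G / Real.log 2)) * Real.log 2 = d * Real.log 2 - η * G := by
    field_simp
  have h2 := mul_lt_mul_of_pos_right hz hlog2
  rw [hδ]
  linarith

end Dimension

/-! ### Range of `α`, size of the bet and choice of parameters. -/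

theorem porosity_le_one {d : ℕ} (hd : 1 ≤ d) (μ : Measure (EuclideanSpace ℝ (Fin d)))
    (x : EuclideanSpace ℝ (Fin d)) {r : ℝ} (hr : 0 < r) (ε : ℝ) : porosity μ x r ε ≤ 1 := by
  have : Nonempty (Fin d) := ⟨⟨0, hd⟩⟩
  refine Real.sSup_le ?_ zero_le_one
  rintro a ⟨ha0, ha⟩
  have hlt := ha.trans_lt ENNReal.ofReal_lt_top
  simp only [iInf_lt_iff] at hlt
  obtain ⟨y, hy, -⟩ := hlt
  -- Antipodal points of the inner ball compare the two diameters; a vector of this norm exists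
  -- because `d ≥ 1`.
  obtain ⟨v, hv⟩ := exists_norm_eq (EuclideanSpace ℝ (Fin d)) (mul_nonneg ha0 hr.le)
  have h1 : y + v ∈ Metric.closedBall x r := hy (by simp [hv])
  have h2 : y - v ∈ Metric.closedBall x r := hy (by simp [hv])
  rw [Metric.mem_closedBall] at h1 h2
  have h3 := dist_triangle_right (y + v) (y - v) x
  have h4 : dist (y + v) (y - v) = 2 * (a * r) := by
    rw [dist_eq_norm, show y + v - (y - v) = (2 : ℝ) • v by module, norm_smul, hv]
    norm_num
  nlinarith

theorem not_meanPorous_of_one_lt {d : ℕ} (hd : 1 ≤ d) {μ : Measure (EuclideanSpace ℝ (Fin d))}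
    [IsProbabilityMeasure μ] {α η ε : ℝ} (hα : 1 < α) (hη : 0 < η) : ¬ MeanPorous μ α η ε := by
  intro h
  obtain ⟨x, hx⟩ := h.exists
  have hempty : ∀ n : ℕ, {i : ℕ | i < n ∧ α ≤ porosity μ x ((2 : ℝ)⁻¹ ^ i) ε} = ∅ := by
    intro n
    rw [Set.eq_empty_iff_forall_notMem]
    rintro i ⟨-, hi⟩
    linarith [porosity_le_one hd μ x (by positivity : (0 : ℝ) < 2⁻¹ ^ i) ε]
  simp only [hempty, Set.ncard_empty, Nat.cast_zero, mul_zero, liminf_const] at hx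
  exact absurd hη hx.not_gt

/-- The proportion bet against a hole of Lebesgue share `q` and relative measure `ε`. -/
noncomputable def betProportion (q ε : ℝ) : ℝ := 9 / 20 * max 0 (1 - |ε| / q)

/-- The logarithmic gain of the bet `betProportion q ε`. -/
noncomputable def betGain (q ε : ℝ) : ℝ :=
  betProportion q ε * q - betProportion q ε / (1 - 2 * betProportion q ε) * ε

theorem betProportion_nonneg (q ε : ℝ) : 0 ≤ betProportion q ε := by
  rw [betProportion]; positivity

theorem betProportion_le {q : ℝ} (hq : 0 < q) (ε : ℝ) : betProportion q ε ≤ 9 / 20 := by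
  have : max 0 (1 - |ε| / q) ≤ 1 :=
    max_le zero_le_one (sub_le_self _ (div_nonneg (abs_nonneg _) hq.le))
  rw [betProportion]
  linarith

/-- The absolute value in `betProportion` keeps the bet at most `9 / 20` for negative `ε` too, so
the denominator never vanishes. -/
theorem continuous_betGain {q : ℝ} (hq : 0 < q) : Continuous (betGain q) := by
  have h : Continuous (betProportion q) := by
    unfold betProportion
    fun_prop
  unfold betGain
  refine (h.mul continuous_const).sub ((h.div (by fun_prop) fun ε => ?_).mul continuous_id)
  linarith [betProportion_le hq ε]

theorem betGain_pos {q ε : ℝ} (hε0 : 0 ≤ ε) (hε : ε < q) : 0 < betGain q ε := by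
  have hq : 0 < q := hε0.trans_lt hε
  have h1 : 0 < 1 - ε / q := by rw [sub_pos, div_lt_one hq]; exact hε
  have h2 : betProportion q ε = 9 / 20 * (1 - ε / q) := by
    rw [betProportion, abs_of_nonneg hε0, max_eq_right h1.le]
  have ha : 0 < betProportion q ε := by rw [h2]; positivity
  have hden : 0 < 1 - 2 * betProportion q ε := by linarith [betProportion_le hq ε]
  -- With the factor `9 / 20` this quantity equals `(q - ε) / 10`.
  have h3 : 0 < q * (1 - 2 * betProportion q ε) - ε := by
    have : q * (ε / q) = ε := by field_simp
    rw [h2]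
    nlinarith
  have h4 : betGain q ε = betProportion q ε *
      (q * (1 - 2 * betProportion q ε) - ε) / (1 - 2 * betProportion q ε) := by
    rw [betGain, eq_div_iff hden.ne', sub_mul, div_mul_eq_mul_div, div_mul_cancel₀ _ hden.ne']
    ring
  rw [h4]
  positivity

theorem betGain_nonneg {q ε : ℝ} (hq : 0 < q) (hε0 : 0 ≤ ε) : 0 ≤ betGain q ε := by
  rcases lt_or_ge ε q with h | h
  · exact (betGain_pos hε0 h).le
  · have h1 : betProportion q ε = 0 := by
      rw [betProportion, abs_of_nonneg hε0, max_eq_left, mul_zero]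
      rw [sub_nonpos, one_le_div hq]
      exact h
    simp [betGain, h1]

theorem betGain_zero (q : ℝ) : betGain q 0 = 9 / 20 * q := by
  simp [betGain, betProportion]

theorem MeanPorous.packingDim_le_betGain {d : ℕ} {μ : Measure (EuclideanSpace ℝ (Fin d))}
    [IsProbabilityMeasure μ] (hd : 1 ≤ d) {α η ε : ℝ} (h : MeanPorous μ α η ε)
    (hε0 : 0 ≤ ε) (hε1 : ε < 1) {κ : ℝ} {N m : ℕ} (hN : Odd N) (hκ : 0 < κ)
    (hκN : 0 ≤ 1 - 2 / κ - 1 / N) (hm : 0 < m) (hα : κ / 2 ^ m < α / √d) :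
    packingDim μ ≤ ((d - η * ((1 - 2 / κ - 1 / N) ^ d * betGain ((2 ^ m)⁻¹ ^ d) ε /
      Real.log 2) : ℝ) : EReal) := by
  have hd0 : (0 : ℝ) < √d := Real.sqrt_pos.mpr (by exact_mod_cast hd)
  have hq : ((2 ^ m : ℝ)⁻¹ ^ d) = (2 ^ d)⁻¹ ^ m := by
    rw [inv_pow, inv_pow, ← pow_mul, ← pow_mul, mul_comm]
  have hq0 : (0 : ℝ) < (2 ^ d)⁻¹ ^ m := by positivity
  rw [hq]
  refine h.packingDim_le hd hε0 hε1 hN hκ hκN hm ?_ (betProportion_nonneg ((2 ^ d)⁻¹ ^ m) ε)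
    (lt_of_le_of_lt (betProportion_le hq0 ε) (by norm_num)) (betGain_nonneg hq0 hε0)
  rwa [mul_comm, ← lt_div_iff₀ hd0]

theorem natCast_rpow_half (d : ℕ) : (d : ℝ) ^ ((d : ℝ) / 2) = √d ^ d := by
  rw [Real.sqrt_eq_rpow, ← Real.rpow_natCast ((d : ℝ) ^ (1 / 2 : ℝ)),
    ← Real.rpow_mul (Nat.cast_nonneg d)]
  ring_nf

theorem porosity_threshold_eq (d : ℕ) (α : ℝ) :
    (2 : ℝ) ^ (-(2 * (d : ℝ))) * (d : ℝ) ^ (-((d : ℝ) / 2)) * α ^ d = (α / √d / 4) ^ d := by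
  have h : (2 : ℝ) ^ (2 * (d : ℝ)) = 4 ^ d := by
    rw [Real.rpow_mul two_pos.le, Real.rpow_natCast]
    norm_num
  rw [Real.rpow_neg two_pos.le, Real.rpow_neg (Nat.cast_nonneg d), natCast_rpow_half, h, div_pow,
    div_pow]
  ring

theorem porosityConst_mul_pow (d : ℕ) (α : ℝ) :
    porosityConst d * α ^ d = 2 / 5 * (α / √d / 16) ^ d / Real.log 2 := by
  rw [porosityConst, natCast_rpow_half, div_pow, div_pow, pow_mul]
  norm_num
  ring

/-- Taking `κ = 4` and `N = 20 d + 1` loses only `9 / 10` beyond `2 ^ (-d)`, by Bernoulli, and `9 /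
20 * (9 / 10) = 81 / 200 > 2 / 5`. -/
theorem porosityConst_lt_betGain {d m : ℕ} (hd : 1 ≤ d) {α : ℝ} (hα : 0 < α)
    (hm : α / √d / 8 ≤ (2 ^ m)⁻¹) :
    porosityConst d * α ^ d <
      (1 - 2 / 4 - 1 / ((20 * d + 1 : ℕ) : ℝ)) ^ d * betGain ((2 ^ m)⁻¹ ^ d) 0 / Real.log 2 := by
  have hlog2 : 0 < Real.log 2 := Real.log_pos one_lt_two
  have hd1 : (1 : ℝ) ≤ d := by exact_mod_cast hd
  have hβ : 0 < α / √d := div_pos hα (Real.sqrt_pos.mpr (by linarith))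
  rw [porosityConst_mul_pow, betGain_zero]
  refine div_lt_div_of_pos_right ?_ hlog2
  set s : ℝ := 1 / ((20 * d + 1 : ℕ) : ℝ) with hs
  have hs0 : 0 < s := by positivity
  have hds : d * s ≤ 1 / 20 := by
    rw [hs, mul_one_div, div_le_div_iff₀ (by positivity) (by norm_num)]
    push_cast
    linarith
  have hs1 : s ≤ 1 / 20 := le_trans (by nlinarith) hds
  have hbern : 9 / 10 ≤ (1 - 2 * s) ^ d := by
    have := one_add_mul_le_pow (show (-2 : ℝ) ≤ -(2 * s) by linarith) d
    rw [← sub_eq_add_neg 1 (2 * s)] at this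
    linarith
  have hle : (1 - 2 * s) ^ d * (α / √d / 16) ^ d ≤ (1 - 2 / 4 - s) ^ d * (2 ^ m)⁻¹ ^ d := by
    rw [← mul_pow, ← mul_pow]
    refine pow_le_pow_left₀ (mul_nonneg (by linarith) (by positivity)) ?_ d
    calc (1 - 2 * s) * (α / √d / 16) = (1 - 2 / 4 - s) * (α / √d / 8) := by ring
      _ ≤ _ := mul_le_mul_of_nonneg_left hm (by linarith)
  have hpos : 0 < (α / √d / 16) ^ d := by positivity
  nlinarith

theorem theorem1p2 (d : ℕ) (hd : 1 ≤ d) (α : ℝ) (hα : 0 < α) :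
    ∃ t : ℝ → ℝ, ContinuousOn t (Set.Ico 0 1) ∧
      (∀ ε : ℝ, 0 ≤ ε → ε < 1 →
        ε < (2 : ℝ) ^ (-(2 * (d : ℝ))) * (d : ℝ) ^ (-((d : ℝ) / 2)) * α ^ d → 0 < t ε) ∧
      (∃ ε₀ : ℝ, 0 < ε₀ ∧ ∀ ε : ℝ, 0 ≤ ε → ε < ε₀ → porosityConst d * α ^ d < t ε) ∧
      (∀ (η ε : ℝ), 0 < η → η ≤ 1 → 0 ≤ ε → ε < 1 →
        ∀ (μ : Measure (EuclideanSpace ℝ (Fin d))) [IsProbabilityMeasure μ],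
          MeanPorous μ α η ε → packingDim μ ≤ (((d : ℝ) - η * t ε : ℝ) : EReal)) := by
  have hlog2 : 0 < Real.log 2 := Real.log_pos one_lt_two
  -- For `α > 1` no measure is mean porous, so any large constant serves.
  rcases lt_or_ge 1 α with hα1 | hα1
  · have hpos : 0 ≤ porosityConst d * α ^ d := by
      rw [porosityConst]
      positivity
    refine ⟨fun _ => porosityConst d * α ^ d + 1, continuousOn_const, fun _ _ _ _ => by positivity,
      ⟨1, one_pos, fun _ _ _ => lt_add_one _⟩, fun η ε hη _ _ _ μ _ h => ?_⟩
    exact absurd h (not_meanPorous_of_one_lt hd hα1 hη)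
  have hd1 : (1 : ℝ) ≤ √d := Real.one_le_sqrt.mpr (by exact_mod_cast hd)
  have hβ0 : 0 < α / √d := by positivity
  have hβ1 : α / √d ≤ 1 := (div_le_one (by linarith)).mpr (hα1.trans hd1)
  -- With `β = α / √d`, this gives `2 ^ (-(k + 1)) < β / 2 ≤ 2 ^ (-k)`.
  obtain ⟨k, hk1, hk2⟩ := exists_nat_pow_near_of_lt_one (x := α / √d / 2) (y := (2 : ℝ)⁻¹)
    (by positivity) (by linarith) (by norm_num) (by norm_num)
  rw [inv_pow, pow_succ, mul_inv] at hk1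
  rw [inv_pow] at hk2
  have hk : (0 : ℝ) < 2 ^ k := by positivity
  have hwide : 2 < α / √d * 2 ^ (k + 1) := by
    rw [pow_succ]
    rw [← mul_inv, inv_lt_iff_one_lt_mul₀ (by positivity)] at hk1
    linarith
  -- Any value strictly between 2 and `β * 2 ^ (k + 1)` works: above 2 some shifts centre the ball,
  -- and below the upper end cells `k + 1` levels deeper fit in the porous ball.
  set κ := (2 + α / √d * 2 ^ (k + 1)) / 2 with hκ
  have hκ2 : 2 < κ := by linarith
  obtain ⟨l, hl⟩ := exists_nat_one_div_lt (show 0 < 1 - 2 / κ by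
    rw [sub_pos, div_lt_one (by linarith)]; exact hκ2)
  have hρ : 0 < 1 - 2 / κ - 1 / ((2 * l + 1 : ℕ) : ℝ) := by
    have : 1 / ((2 * l + 1 : ℕ) : ℝ) ≤ 1 / ((l : ℝ) + 1) := by
      apply one_div_le_one_div_of_le (by positivity)
      push_cast
      linarith [(Nat.cast_nonneg l : (0 : ℝ) ≤ l)]
    linarith
  -- `tA` uses deeper holes in roomier cells and gives the constant near 0; `tB` uses larger holes,
  -- of share at least `(β / 4) ^ d`, and is positive on the whole required range.
  set tA : ℝ → ℝ := fun ε => (1 - 2 / 4 - 1 / ((20 * d + 1 : ℕ) : ℝ)) ^ d *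
    betGain ((2 ^ (k + 2))⁻¹ ^ d) ε / Real.log 2 with htA
  set tB : ℝ → ℝ := fun ε => (1 - 2 / κ - 1 / ((2 * l + 1 : ℕ) : ℝ)) ^ d *
    betGain ((2 ^ (k + 1))⁻¹ ^ d) ε / Real.log 2 with htB
  have hcA : Continuous tA :=
    ((continuous_betGain (by positivity)).const_mul _).div_const _
  have hcB : Continuous tB :=
    ((continuous_betGain (by positivity)).const_mul _).div_const _
  have hA0 : porosityConst d * α ^ d < tA 0 :=
    porosityConst_lt_betGain hd hα (by rw [pow_add, mul_inv]; linarith)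
  refine ⟨fun ε => max (tA ε) (tB ε), (hcA.max hcB).continuousOn, ?_, ?_, ?_⟩
  · intro ε hε0 _ hε
    refine lt_max_of_lt_right ?_
    rw [porosity_threshold_eq] at hε
    have hq : (α / √d / 4) ^ d ≤ (2 ^ (k + 1))⁻¹ ^ d := by
      refine pow_le_pow_left₀ (by positivity) ?_ d
      rw [pow_succ, mul_inv]
      linarith
    have := betGain_pos hε0 (hε.trans_le hq)
    positivity
  · obtain ⟨ε₀, hε₀, hball⟩ := Metric.eventually_nhds_iff.mp
      (hcA.continuousAt.eventually (lt_mem_nhds hA0))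
    refine ⟨ε₀, hε₀, fun ε hε0 hε => lt_max_of_lt_left (hball ?_)⟩
    rwa [Real.dist_eq, sub_zero, abs_of_nonneg hε0]
  · intro η ε hη _ hε0 hε1 μ _ h
    rcases max_choice (tA ε) (tB ε) with ht | ht
    · simp only [ht]
      refine h.packingDim_le_betGain hd hε0 hε1 (κ := 4) (N := 20 * d + 1) (m := k + 2)
        ⟨10 * d, by ring⟩ (by norm_num) ?_ (by omega) ?_
      · have h1 : 1 / ((20 * d + 1 : ℕ) : ℝ) ≤ 1 / 2 := by
          apply one_div_le_one_div_of_le two_pos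
          have : (1 : ℝ) ≤ d := by exact_mod_cast hd
          push_cast
          linarith
        linarith
      · rw [pow_add, div_eq_mul_inv, mul_inv]
        linarith
    · simp only [ht]
      refine h.packingDim_le_betGain hd hε0 hε1 (κ := κ) (N := 2 * l + 1) (m := k + 1)
        ⟨l, rfl⟩ (by linarith) hρ.le (by omega) ?_
      rw [div_lt_iff₀ (by positivity)]
      linarith
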